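/- Let $T>0$, let $L:[0,T]\to\mathbb R^{2\times2}$ be continuous with symmetric values (for instance, the restriction to $[0,T]$ of a continuous $T$-periodic function), let $J=\begin{pmatrix}0&1\\-1&0\end{pmatrix}$, and let $\Psi$ be the fundamental matrix of $\dot z=JL(t)z$ with $\Psi(0)=I$. Assume that the system is $T$-nonresonant: $\det(I-\Psi(T))\neq0$. *Maslov index.* Every $A\in \mathrm{Sp}(1)=SL(2,\mathbb R)$ is uniquely $A=P\,R(\theta)$ with $P$ symmetric positive definite, $\det P=1$, and $R(\theta)=\begin{pmatrix}\cos\theta&\sin\theta\\-\sin\theta&\cos\theta\end{pmatrix}$, with $\theta$ unique modulo $2\pi$. Extend the path $\Psi:[0,T]\to \mathrm{Sp}(1)$ to a continuous path $\hat\Psi:[0,T+1]\to \mathrm{Sp}(1)$ with $\det(I-\hat\Psi(t))\ne0$ on $[T,T+1]$, which ends at $-I$ if $\det(I-\Psi(T))>0$, and at $\begin{pmatrix}2&0\\0&1/2\end{pmatrix}$ if $\det(I-\Psi(T))<0$. Let $\theta(t)$ be the continuous angle of the rotation factor of $\hat\Psi(t)$, with $\theta(0)=0$. The $T$-Maslov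 index is the integer $i_T(\Psi)=-\theta(T+1)/\pi$, the number of counter-clockwise half-windings of $\hat\Psi$; it does not depend on the extension. *Lifted displacement map.* Let $\Pi(\phi,r)=(r\cos\phi,-r\sin\phi)$. Let $\mathcal P:[0,T]\times\mathbb R\times(0,\infty)\to\mathbb R\times(0,\infty)$ be the continuous map with $\mathcal P(0,\phi,r)=(\phi,r)$ and $\Pi(\mathcal P(t,\phi,r))=\Psi(t)\,\Pi(\phi,r)$. Put $\mathcal P_T=\mathcal P(T,\cdot,\cdot)$ and $F(\phi,r)=\mathcal P_T(\phi,r)-(\phi,r)$. *Degree at a fixed radius.* Let $f:\mathbb R\times(0,\infty)\to\mathbb R^2$ be continuous, $2\pi$-periodic in the first variable, and let $r>0$ be such that $f(\phi,r)\ne0$ for every $\phi$. Choose a continuous $\tilde f:\mathbb R\times[0,\infty)\to\mathbb R^2$, $2\pi$-periodic in the first variable, with $\tilde f(\cdot,0)\equiv0$ and $\tilde f(\cdot,r)=f(\cdot,r)$, and put $\mathfrak D(f,r)=\deg(\tilde f\circ\Pi^{-1},\mathcal B(0,r),0)$, where $\deg$ is the Brouwer degree and $\mathcal B(0,r)$ is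 the open disc of radius $r$ about $0$; this does not depend on the choice of $\tilde f$. Then the following hold, and all the degrees in them are defined. 1. If $i_T(\Psi)=0$, then $\mathfrak D(F,r)=-2$ for every $r>0$. If $i_T(\Psi)\ne0$, then $\mathfrak D(F,r)=0$ for every $r>0$. 2. For every $M\in\mathbb Z$: if $i_T(\Psi)=2M$, then $\mathfrak D(F+(2M\pi,0),r)=-2$ for every $r>0$; if $i_T(\Psi)\ne2M$, then $\mathfrak D(F+(2M\pi,0),r)=0$ for every $r>0$. -/

import Mathlib

open Set
open scoped ContDiff Matrix

noncomputable section

/-- The Euclidean plane. -/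
abbrev Plane : Type := EuclideanSpace ℝ (Fin 2)

/-- Real two by two matrices. -/
abbrev Mat2 : Type := Matrix (Fin 2) (Fin 2) ℝ

/-! ### The Brouwer degree in the plane

The definition is the analytic one, by the integral formula of Heinz: the map `f` is approximated
by a smooth map `g`, uniformly on the closure of `U`, and
`deg (f, U, y) = ∫_U Φ(|g x - y|) det (Dg x) dx`
for a radial weight `Φ(|w|)` of total mass one that lives so close to the origin that
`Φ(|g x - y|)` vanishes near the boundary of `U`. -/

/-- `g`, `Φ`, `ε` are admissible for the computation of `deg (f, U, y)`. -/
structure IsHeinzData (f : Plane → Plane) (U : Set Plane) (y : Plane)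
    (g : Plane → Plane) (Φ : ℝ → ℝ) (ε : ℝ) : Prop where
  pos : 0 < ε
  /-- The point `y` has distance at least `2 ε` from the image of the boundary. -/
  sep : ∀ x ∈ frontier U, 2 * ε ≤ ‖f x - y‖
  smooth : ContDiff ℝ ∞ g
  close : ∀ x ∈ closure U, ‖g x - f x‖ < ε
  weight_cont : Continuous Φ
  weight_near : ∃ a > 0, ∀ s ≤ a, Φ s = 0
  weight_far : ∀ s ≥ ε, Φ s = 0
  weight_mass : ∫ w : Plane, Φ ‖w‖ = 1

/-- `d` is the Brouwer degree `deg (f, U, y)`: it is defined (`U` is open and bounded, `f` is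
continuous on the closure of `U` and does not take the value `y` on the boundary), admissible
data exist, and every choice of them gives the value `d`. -/
def HasBrouwerDegree (f : Plane → Plane) (U : Set Plane) (y : Plane) (d : ℤ) : Prop :=
  IsOpen U ∧ Bornology.IsBounded U ∧ ContinuousOn f (closure U) ∧
  (∀ x ∈ frontier U, f x ≠ y) ∧
  (∃ g Φ ε, IsHeinzData f U y g Φ ε) ∧
  ∀ g Φ ε, IsHeinzData f U y g Φ ε →
    ∫ x in U, Φ ‖g x - y‖ * (fderiv ℝ g x).det = (d : ℝ)

/-! ### Clockwise polar coordinates and the degree at a fixed radius -/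

/-- The clockwise polar coordinates `Π(φ, r) = (r cos φ, - r sin φ)`. -/
def polarProj (φ r : ℝ) : Plane := !₂[r * Real.cos φ, -(r * Real.sin φ)]

/-- `fr` is a continuous map on `ℝ × [0, ∞)`, `2π`-periodic in the angle, that vanishes at
radius `0` and agrees with `f` at radius `r`. -/
structure IsRadialExtension (f : ℝ → ℝ → Plane) (r : ℝ) (fr : ℝ → ℝ → Plane) : Prop where
  cont : ContinuousOn (fun p : ℝ × ℝ => fr p.1 p.2) (univ ×ˢ Ici 0)
  periodic : ∀ φ, ∀ ρ ≥ 0, fr (φ + 2 * Real.pi) ρ = fr φ ρ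
  at_zero : ∀ φ, fr φ 0 = 0
  at_radius : ∀ φ, fr φ r = f φ r

/-- `h` is the map `fr ∘ Π⁻¹` of the plane, for some admissible extension `fr` of `f(·, r)`.
As `Π` maps `ℝ × [0, ∞)` onto the plane, `h` is determined by `fr`. -/
def IsPlanarExtension (f : ℝ → ℝ → Plane) (r : ℝ) (h : Plane → Plane) : Prop :=
  ∃ fr, IsRadialExtension f r fr ∧ ∀ φ, ∀ ρ ≥ 0, h (polarProj φ ρ) = fr φ ρ

/-- `d` is the degree `𝔇(f, r)` of `f` at the fixed radius `r`: the Brouwer degree at `0`, on the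
disc of radius `r`, of `fr ∘ Π⁻¹`, for any admissible extension `fr` of `f(·, r)`. Here `f` is a
continuous map on `ℝ × (0, ∞)`; it has an admissible extension, and the degree does not depend
on the extension. -/
def HasFixedRadiusDegree (f : ℝ → ℝ → Plane) (r : ℝ) (d : ℤ) : Prop :=
  ContinuousOn (fun p : ℝ × ℝ => f p.1 p.2) (univ ×ˢ Ioi 0) ∧
  (∃ h, IsPlanarExtension f r h) ∧
  ∀ h, IsPlanarExtension f r h → HasBrouwerDegree h (Metric.ball 0 r) 0 d

/-! ### Planar linear Hamiltonian systems -/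

/-- The matrix `J` of the Hamiltonian system `z' = J L(t) z`. -/
def matJ : Mat2 := !![0, 1; -1, 0]

/-- `Ψ` is, on `[0, T]`, the fundamental matrix of `z' = J L(t) z` with `Ψ(0) = I`
(the derivative is taken entrywise, and one-sided at the end points). -/
def IsFundamentalMatrix (L : ℝ → Mat2) (T : ℝ) (Ψ : ℝ → Mat2) : Prop :=
  Ψ 0 = 1 ∧ ∀ t ∈ Icc 0 T, ∀ i j : Fin 2,
    HasDerivWithinAt (fun s => Ψ s i j) ((matJ * L t * Ψ t) i j) (Icc 0 T) t

/-- `P`, with `P t φ r` for `𝒫(t, φ, r)`, is the lift of the flow `z ↦ Ψ(t) z` on the punctured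
plane, for `t ∈ [0, T]`, to the universal covering `Π : ℝ × (0, ∞) → ℝ² \ {0}`, starting from the
identity. -/
structure IsPolarLift (Ψ : ℝ → Mat2) (T : ℝ) (P : ℝ → ℝ → ℝ → ℝ × ℝ) : Prop where
  cont : ContinuousOn (fun p : ℝ × ℝ × ℝ => P p.1 p.2.1 p.2.2) (Icc 0 T ×ˢ univ ×ˢ Ioi 0)
  radius_pos : ∀ t ∈ Icc 0 T, ∀ φ, ∀ r > 0, 0 < (P t φ r).2
  start : ∀ φ, ∀ r > 0, P 0 φ r = (φ, r)
  lift : ∀ t ∈ Icc 0 T, ∀ φ, ∀ r > 0,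
    polarProj (P t φ r).1 (P t φ r).2 = WithLp.toLp 2 (Ψ t *ᵥ (polarProj φ r).ofLp)

/-- The displacement `F(φ, r) = 𝒫(T, φ, r) - (φ, r)` of the lifted time `T` map. -/
def displacement (P : ℝ → ℝ → ℝ → ℝ × ℝ) (T : ℝ) (φ r : ℝ) : Plane :=
  !₂[(P T φ r).1 - φ, (P T φ r).2 - r]

/-! ### The Maslov index -/

/-- The clockwise rotation of angle `θ`. -/
def rotMat (θ : ℝ) : Mat2 := !![Real.cos θ, Real.sin θ; -Real.sin θ, Real.cos θ]

/-- The hyperbolic rotations; these are the positive definite matrices of determinant one. -/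
def hypMat (τ σ : ℝ) : Mat2 :=
  !![Real.cosh τ + Real.sinh τ * Real.cos σ, Real.sinh τ * Real.sin σ;
     Real.sinh τ * Real.sin σ, Real.cosh τ - Real.sinh τ * Real.cos σ]

/-- `i` counts the counter-clockwise half-windings of an extension `E : [0, T + 1] → Sp(1)` of
the path `Ψ : [0, T] → Sp(1)`. On `[T, T + 1]` the extension avoids the resonant matrices, those
with `det (I - M) = 0`, and it ends at `-I` if `det (I - Ψ(T)) > 0`, and at `diag (2, 1/2)` if
`det (I - Ψ(T)) < 0`. The winding is measured by the continuous angle `θ`, with `θ(0) = 0`, of the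
rotation in the decomposition `E(t) = P(τ, σ) R(θ(t))`; as `R(θ)` is the clockwise rotation, the
number of counter-clockwise half-windings is `- θ(T + 1) / π`. -/
def IsMaslovIndex (Ψ : ℝ → Mat2) (T : ℝ) (i : ℤ) : Prop :=
  ∃ (E : ℝ → Mat2) (θ : ℝ → ℝ),
    ContinuousOn E (Icc 0 (T + 1)) ∧
    (∀ t ∈ Icc 0 T, E t = Ψ t) ∧
    (∀ t ∈ Icc T (T + 1), (1 - E t).det ≠ 0) ∧
    (0 < (1 - Ψ T).det → E (T + 1) = -1) ∧
    ((1 - Ψ T).det < 0 → E (T + 1) = !![2, 0; 0, 1 / 2]) ∧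
    ContinuousOn θ (Icc 0 (T + 1)) ∧
    θ 0 = 0 ∧
    (∀ t ∈ Icc 0 (T + 1), ∃ τ σ : ℝ, 0 ≤ τ ∧ E t = hypMat τ σ * rotMat (θ t)) ∧
    θ (T + 1) = -((i : ℝ) * Real.pi)

/-- The `T`-Maslov index `i_T(Ψ)` of a path with `Ψ(0) = I` and `det (I - Ψ(T)) ≠ 0` in the
symplectic group `Sp(1)`: the integer with the property above. -/
def maslovIndex (Ψ : ℝ → Mat2) (T : ℝ) : ℤ :=
  Classical.epsilon fun i : ℤ => IsMaslovIndex Ψ T i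

end

/-!
Two facts carry the theorem: the degree at a fixed radius is a winding number, and the Maslov index
records the rotation of the flow up to an error of less than half a turn.

*Degree and winding.* A radial weight `Φ(|w|) dw₁ ∧ dw₂` is the differential of
`K(|w|²) (w₁ dw₂ - w₂ dw₁)`, which outside the support of `Φ` is a multiple of the angular form.
Green's formula in polar coordinates turns the Heinz integral over a disc into the integral of the
angular form along the image of the boundary circle, that is, into a winding number; the mass of the
weight is the same integral for the identity map and fixes the factor (`integral_ball_eq_winding`).
Winding numbers do not change when a loop is replaced by one that never points in the opposite
direction (`HasWinding.of_div_mem_slitPlane`); so they survive smooth approximation, and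
`hasFixedRadiusDegree_of_hasWinding` follows. There the sign changes, because the polar coordinates
`Π` run clockwise.

*Rotation.* Write `Ψ(t)` as a positive definite matrix times `R(θ(t))`. The first factor turns every
vector by less than `π / 2`, so the polar lift of every orbit has turned by `θ(t)` up to `π / 2`
(`IsPolarLift.abs_angle_sub_lt`). With `det (I - P(τ, σ) R(θ)) = 2 (1 - cosh τ cos θ)`, a
nonresonant path with `det (I - E) < 0` has `cos θ > 0` throughout. Hence the Maslov index is `2M`
exactly if `det (I - Ψ(T)) < 0` and `|θ(T) + 2Mπ| < π / 2` (`IsMaslovIndex.exists_angle`). That the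
index exists is shown by explicit nonresonant paths in the parameters `(τ, σ, θ)`
(`IsPolarLift.exists_isMaslovIndex`).

*Displacement.* Let `δ(φ)` be the angular displacement at time `T` plus `2Mπ`, and `ρ(φ)` the final
radius. A zero of `δ` means that `Ψ(T)` has a positive eigenvalue, so `det (I - Ψ(T)) < 0` and the
index is `2M`. For every other index the loop `(δ, ρ - r)` stays in a half-plane and its winding
number is `0`. If the index is `2M`, then `|δ| < π`, and `(ρ - r) + iδ` is never opposite to
`(ρ / r) e^{iδ} - 1`, which in the complex coordinate `w = x - iy` is `(Ψ(T) w - w) / w`. The latter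
is `(p - 1) + q e^{-2iφ}` with `|q|² - |p - 1|² = -det (I - Ψ(T)) > 0`, so its winding number is
`-2`. Passing to `(δ, ρ - r)` reverses the orientation, passing to the degree reverses it again, and
the degree is `-2`.
-/

open Real MeasureTheory

/-! ### Winding numbers of loops -/

/-- `c` is a `2π`-periodic loop in `ℂ \ {0}` with winding number `n` about the origin: it has a
continuous logarithm `ℓ` that grows by `2πin` over a period. -/
def HasWinding (c : ℝ → ℂ) (n : ℤ) : Prop :=
  ∃ ℓ : ℝ → ℂ, Continuous ℓ ∧ (∀ θ, Complex.exp (ℓ θ) = c θ) ∧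
    ∀ θ, ℓ (θ + 2 * π) = ℓ θ + 2 * π * n * Complex.I

namespace HasWinding

variable {c c' : ℝ → ℂ} {n : ℤ}

theorem ne_zero (h : HasWinding c n) (θ : ℝ) : c θ ≠ 0 := by
  obtain ⟨ℓ, -, h, -⟩ := h
  rw [← h]; exact Complex.exp_ne_zero _

theorem continuous (h : HasWinding c n) : Continuous c := by
  obtain ⟨ℓ, hc, h, -⟩ := h
  rw [← funext h]; fun_prop

theorem periodic (h : HasWinding c n) (θ : ℝ) : c (θ + 2 * π) = c θ := by
  obtain ⟨ℓ, -, h, hp⟩ := h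
  rw [← h, ← h, hp, Complex.exp_add,
    show (2 * π * n * Complex.I : ℂ) = n * (2 * π * Complex.I) by ring,
    Complex.exp_int_mul_two_pi_mul_I, mul_one]

/-- Two loops whose pointwise quotient avoids the negative half-axis have the same winding
number. -/
theorem of_div_mem_slitPlane (h : HasWinding c n) (hc' : Continuous c')
    (hp : ∀ θ, c' (θ + 2 * π) = c' θ) (hs : ∀ θ, c' θ / c θ ∈ Complex.slitPlane) :
    HasWinding c' n := by
  have hc := h.continuous
  have h0 := h.ne_zero
  have hper := h.periodic
  obtain ⟨ℓ, hℓ, he, hℓp⟩ := h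
  refine ⟨fun θ => ℓ θ + Complex.log (c' θ / c θ),
    hℓ.add ((hc'.div hc h0).clog hs), fun θ => ?_, fun θ => ?_⟩
  · have : c' θ / c θ ≠ 0 := Complex.slitPlane_ne_zero (hs θ)
    rw [Complex.exp_add, he, Complex.exp_log this, mul_div_cancel₀ _ (h0 θ)]
  · simp only [hℓp, hp, hper]; ring

theorem comp_neg (h : HasWinding c n) : HasWinding (fun θ => c (-θ)) (-n) := by
  obtain ⟨ℓ, hℓ, he, hp⟩ := h
  refine ⟨fun θ => ℓ (-θ), by fun_prop, fun θ => he _, fun θ => ?_⟩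
  have := hp (-(θ + 2 * π))
  rw [show -(θ + 2 * π) + 2 * π = -θ by ring] at this
  simp only [this]; push_cast; ring

theorem conj (h : HasWinding c n) : HasWinding (fun θ => starRingEnd ℂ (c θ)) (-n) := by
  obtain ⟨ℓ, hℓ, he, hp⟩ := h
  refine ⟨fun θ => starRingEnd ℂ (ℓ θ), by fun_prop, fun θ => ?_, fun θ => ?_⟩
  · simp only [← he, Complex.exp_conj]
  · simp only [hp, map_add, map_mul, Complex.conj_I, Complex.conj_ofReal, map_intCast, map_ofNat]
    push_cast; ring

theorem const_mul (h : HasWinding c n) {a : ℂ} (ha : a ≠ 0) :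
    HasWinding (fun θ => a * c θ) n := by
  obtain ⟨ℓ, hℓ, he, hp⟩ := h
  refine ⟨fun θ => Complex.log a + ℓ θ, by fun_prop, fun θ => ?_, fun θ => ?_⟩
  · simp only [Complex.exp_add, Complex.exp_log ha, he]
  · simp only [hp]; ring

theorem exp_int_mul (n : ℤ) : HasWinding (fun θ => Complex.exp (n * θ * Complex.I)) n :=
  ⟨fun θ => n * θ * Complex.I, by fun_prop, fun θ => rfl, fun θ => by push_cast; ring⟩

theorem one : HasWinding (fun _ => 1) 0 :=
  ⟨fun _ => 0, by fun_prop, fun θ => by simp, fun θ => by simp⟩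

/-- The winding number of a continuously differentiable loop as the integral of the logarithmic
derivative. -/
theorem integral_div (h : HasWinding c n) {d : ℝ → ℂ} (hd : ∀ θ, HasDerivAt c (d θ) θ)
    (hdc : Continuous d) : ∫ θ in (-π)..π, d θ / c θ = 2 * π * n * Complex.I := by
  have h0 := h.ne_zero
  have hc := h.continuous
  obtain ⟨ℓ, hℓ, he, hp⟩ := h
  have hderiv : ∀ θ, HasDerivAt ℓ (d θ / c θ) θ := by
    intro θ
    -- near `θ` the lift differs from a local branch of the logarithm of `c / c θ` by a constant
    have hev : ∀ᶠ x in nhds θ, ℓ x = ℓ θ + Complex.log (c x / c θ) := by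
      have h1 : Filter.Tendsto (fun x => (ℓ x - ℓ θ).im) (nhds θ) (nhds 0) := by
        have : Continuous fun x => (ℓ x - ℓ θ).im := by fun_prop
        simpa using this.tendsto θ
      filter_upwards [h1.eventually_const_lt (show -π < 0 by linarith [pi_pos]),
        h1.eventually_lt_const pi_pos] with x hx1 hx2
      rw [← he x, ← he θ, ← Complex.exp_sub, Complex.log_exp hx1 hx2.le]; ring
    have h2 : HasDerivAt (fun x => c x / c θ) (d θ / c θ) θ := (hd θ).div_const _
    have h3 : c θ / c θ ∈ Complex.slitPlane := by simp [div_self (h0 θ)]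
    have h4 := (h2.clog_real h3).const_add (ℓ θ)
    rw [div_self (h0 θ), div_one] at h4
    exact h4.congr_of_eventuallyEq hev
  rw [intervalIntegral.integral_eq_sub_of_hasDerivAt (fun θ _ => hderiv θ)
    ((hdc.div hc h0).intervalIntegrable _ _)]
  have := hp (-π)
  rw [show -π + 2 * π = π by ring] at this
  rw [this]; ring

end HasWinding

/-! ### Polar coordinates and Green's formula -/

theorem Plane.det_eq (A : Plane →L[ℝ] Plane) :
    A.det = A !₂[1, 0] 0 * A !₂[0, 1] 1 - A !₂[0, 1] 0 * A !₂[1, 0] 1 := by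
  have h0 : EuclideanSpace.single (0 : Fin 2) (1 : ℝ) = !₂[1, 0] := by
    ext i; fin_cases i <;> simp
  have h1 : EuclideanSpace.single (1 : Fin 2) (1 : ℝ) = !₂[0, 1] := by
    ext i; fin_cases i <;> simp
  rw [ContinuousLinearMap.det,
    ← LinearMap.det_toMatrix (EuclideanSpace.basisFun (Fin 2) ℝ).toBasis, Matrix.det_fin_two]
  simp [LinearMap.toMatrix_apply, h0, h1]

/-- Standard polar coordinates in the plane. -/
noncomputable def polarPoint (p : ℝ × ℝ) : Plane := !₂[p.1 * cos p.2, p.1 * sin p.2]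

theorem contDiff_polarPoint : ContDiff ℝ ∞ polarPoint := by
  rw [contDiff_euclidean]
  intro i
  fin_cases i <;> simp [polarPoint] <;> fun_prop

theorem fderiv_polarPoint_one_zero (p : ℝ × ℝ) :
    fderiv ℝ polarPoint p (1, 0) = !₂[cos p.2, sin p.2] := by
  have hd := (contDiff_polarPoint.differentiable (by simp)) p
  have h := hd.hasFDerivAt.comp_hasDerivAt_of_eq p.1
    ((hasDerivAt_id p.1).prodMk (hasDerivAt_const p.1 p.2)) rfl
  ext i
  refine ((EuclideanSpace.proj (𝕜 := ℝ) i).hasFDerivAt.comp_hasDerivAt p.1 h).unique ?_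
  fin_cases i
  · have h' : HasDerivAt (fun y => y * cos p.2) (cos p.2) p.1 := by
      simpa using (hasDerivAt_id p.1).mul_const (cos p.2)
    exact h'
  · have h' : HasDerivAt (fun y => y * sin p.2) (sin p.2) p.1 := by
      simpa using (hasDerivAt_id p.1).mul_const (sin p.2)
    exact h'

theorem fderiv_polarPoint_zero_one (p : ℝ × ℝ) :
    fderiv ℝ polarPoint p (0, 1) = !₂[-(p.1 * sin p.2), p.1 * cos p.2] := by
  have hd := (contDiff_polarPoint.differentiable (by simp)) p
  have h := hd.hasFDerivAt.comp_hasDerivAt_of_eq p.2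
    ((hasDerivAt_const p.2 p.1).prodMk (hasDerivAt_id p.2)) rfl
  ext i
  refine ((EuclideanSpace.proj (𝕜 := ℝ) i).hasFDerivAt.comp_hasDerivAt p.2 h).unique ?_
  fin_cases i
  · have h' : HasDerivAt (fun y => p.1 * cos y) (-(p.1 * sin p.2)) p.2 := by
      simpa using (hasDerivAt_cos p.2).const_mul p.1
    exact h'
  · exact (hasDerivAt_sin p.2).const_mul p.1

/-- Integration over a disc in polar coordinates. -/
theorem setIntegral_ball_eq_polar {H : Plane → ℝ} (hH : Continuous H) {R : ℝ} (hR : 0 < R) :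
    ∫ x in Metric.ball (0 : Plane) R, H x =
      ∫ ρ in (0 : ℝ)..R, ∫ θ in (-π)..π, ρ * H (polarPoint (ρ, θ)) := by
  -- the plane as `ℝ × ℝ`
  let e : ℝ × ℝ ≃ᵐ Plane :=
    (MeasurableEquiv.finTwoArrow (α := ℝ)).symm.trans (MeasurableEquiv.toLp 2 (Fin 2 → ℝ))
  have he : MeasurePreserving e volume volume :=
    (PiLp.volume_preserving_toLp (Fin 2)).comp (volume_preserving_finTwoArrow ℝ).symm
  have hep : ∀ p : ℝ × ℝ, e (polarCoord.symm p) = polarPoint p := by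
    intro p
    ext i
    fin_cases i <;> rfl
  have hnorm : ∀ p : ℝ × ℝ, ‖polarPoint p‖ = |p.1| := by
    intro p
    rw [EuclideanSpace.norm_eq, ← Real.sqrt_sq_eq_abs]
    congr 1
    simp [polarPoint, Fin.sum_univ_two]
    linear_combination p.1 ^ 2 * cos_sq_add_sin_sq p.2
  rw [← integral_indicator Metric.isOpen_ball.measurableSet,
    ← he.integral_comp e.measurableEmbedding, ← integral_comp_polarCoord_symm]
  have hcont : Continuous fun p : ℝ × ℝ => p.1 * H (polarPoint p) :=
    continuous_fst.mul (hH.comp contDiff_polarPoint.continuous)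
  have h1 : ∀ p ∈ polarCoord.target,
      p.1 • (Metric.ball (0 : Plane) R).indicator H (e (polarCoord.symm p)) =
        (Iio R ×ˢ univ).indicator (fun p : ℝ × ℝ => p.1 * H (polarPoint p)) p := by
    intro p hp
    have hp0 : 0 < p.1 := hp.1
    rw [hep, smul_eq_mul]
    by_cases h : p.1 < R
    · rw [indicator_of_mem, indicator_of_mem]
      · exact ⟨h, trivial⟩
      · simpa [hnorm, abs_of_pos hp0] using h
    · rw [indicator_of_notMem, indicator_of_notMem, mul_zero]
      · exact fun h' => h h'.1
      · simpa [hnorm, abs_of_pos hp0] using h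
  rw [setIntegral_congr_fun polarCoord.open_target.measurableSet h1,
    setIntegral_indicator (measurableSet_Iio.prod MeasurableSet.univ)]
  have h2 : polarCoord.target ∩ Iio R ×ˢ univ = Ioo 0 R ×ˢ Ioo (-π) π := by
    ext p; simp [polarCoord, and_assoc, and_comm, and_left_comm]
  rw [h2, Measure.volume_eq_prod, setIntegral_prod _ ?_]
  · rw [intervalIntegral.integral_of_le hR.le, ← integral_Ioc_eq_integral_Ioo]
    congr 1
    ext ρ
    rw [intervalIntegral.integral_of_le (by linarith [pi_pos]), ← integral_Ioc_eq_integral_Ioo]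
  · rw [← Measure.volume_eq_prod]
    exact (hcont.continuousOn.integrableOn_compact
      (isCompact_Icc.prod isCompact_Icc : IsCompact (Icc 0 R ×ˢ Icc (-π) π))).mono_set
      (prod_mono Ioo_subset_Icc_self Ioo_subset_Icc_self)

/-- Green's formula for the pull-back of the form `K(|w|²) (w₁ dw₂ - w₂ dw₁)` by the map
`(u, v)`. -/
theorem integral_jacobian_rectangle {u v : ℝ × ℝ → ℝ} (hu : ContDiff ℝ ∞ u) (hv : ContDiff ℝ ∞ v)
    {K K' n : ℝ → ℝ} (hK : ∀ x, HasDerivAt K (K' x) x) (hn : Continuous n)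
    (h : ∀ x, 2 * (x * K' x) + 2 * K x = n x) (a b c d : ℝ) :
    ∫ ρ in a..b, ∫ θ in c..d, n (u (ρ, θ) ^ 2 + v (ρ, θ) ^ 2) *
      (fderiv ℝ u (ρ, θ) (1, 0) * fderiv ℝ v (ρ, θ) (0, 1) -
        fderiv ℝ u (ρ, θ) (0, 1) * fderiv ℝ v (ρ, θ) (1, 0)) =
    (((∫ ρ in a..b, -(K (u (ρ, d) ^ 2 + v (ρ, d) ^ 2) *
        (u (ρ, d) * fderiv ℝ v (ρ, d) (1, 0) - v (ρ, d) * fderiv ℝ u (ρ, d) (1, 0)))) -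
      ∫ ρ in a..b, -(K (u (ρ, c) ^ 2 + v (ρ, c) ^ 2) *
        (u (ρ, c) * fderiv ℝ v (ρ, c) (1, 0) - v (ρ, c) * fderiv ℝ u (ρ, c) (1, 0)))) +
      ∫ θ in c..d, K (u (b, θ) ^ 2 + v (b, θ) ^ 2) *
        (u (b, θ) * fderiv ℝ v (b, θ) (0, 1) - v (b, θ) * fderiv ℝ u (b, θ) (0, 1))) -
      ∫ θ in c..d, K (u (a, θ) ^ 2 + v (a, θ) ^ 2) *
        (u (a, θ) * fderiv ℝ v (a, θ) (0, 1) - v (a, θ) * fderiv ℝ u (a, θ) (0, 1)) := by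
  have hu1 : Differentiable ℝ u := hu.differentiable (by simp)
  have hv1 : Differentiable ℝ v := hv.differentiable (by simp)
  have hu2 : ContDiff ℝ ∞ (fderiv ℝ u) := hu.fderiv_right (by simp)
  have hv2 : ContDiff ℝ ∞ (fderiv ℝ v) := hv.fderiv_right (by simp)
  have hKc : Continuous K := continuous_iff_continuousAt.2 fun x => (hK x).continuousAt
  -- the coefficient of the form along a direction `w` is differentiable
  obtain ⟨D, hD, hcurl⟩ : ∃ D : ℝ × ℝ → ℝ × ℝ → ℝ × ℝ →L[ℝ] ℝ,
      (∀ w p, HasFDerivAt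
        (fun p => K (u p ^ 2 + v p ^ 2) * (u p * fderiv ℝ v p w - v p * fderiv ℝ u p w))
        (D w p) p) ∧
      ∀ p, D (0, 1) p (1, 0) + (-D (1, 0) p) (0, 1) = n (u p ^ 2 + v p ^ 2) *
        (fderiv ℝ u p (1, 0) * fderiv ℝ v p (0, 1) -
          fderiv ℝ u p (0, 1) * fderiv ℝ v p (1, 0)) := by
    refine ⟨fun w p => K (u p ^ 2 + v p ^ 2) •
        ((u p • ((fderiv ℝ (fderiv ℝ v) p).flip w) + fderiv ℝ v p w • fderiv ℝ u p) -
          (v p • ((fderiv ℝ (fderiv ℝ u) p).flip w) + fderiv ℝ u p w • fderiv ℝ v p)) +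
        (u p * fderiv ℝ v p w - v p * fderiv ℝ u p w) •
          (K' (u p ^ 2 + v p ^ 2) • (2 * u p) • fderiv ℝ u p +
            K' (u p ^ 2 + v p ^ 2) • (2 * v p) • fderiv ℝ v p), fun w p => ?_, fun p => ?_⟩
    · have du := (hu1 p).hasFDerivAt
      have dv := (hv1 p).hasFDerivAt
      have ddu : HasFDerivAt (fun p => fderiv ℝ u p w) ((fderiv ℝ (fderiv ℝ u) p).flip w) p := by
        simpa using ((hu2.differentiable (by simp)) p).hasFDerivAt.clm_apply
          (hasFDerivAt_const w p)
      have ddv : HasFDerivAt (fun p => fderiv ℝ v p w) ((fderiv ℝ (fderiv ℝ v) p).flip w) p := by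
        simpa using ((hv2.differentiable (by simp)) p).hasFDerivAt.clm_apply
          (hasFDerivAt_const w p)
      have dK := (hK (u p ^ 2 + v p ^ 2)).comp_hasFDerivAt p ((du.pow 2).add (dv.pow 2))
      convert! dK.mul ((du.mul ddv).sub (dv.mul ddu)) using 1
      ext <;> simp
    · -- the second derivatives cancel by symmetry
      have hsu : fderiv ℝ (fderiv ℝ u) p (1, 0) (0, 1) = fderiv ℝ (fderiv ℝ u) p (0, 1) (1, 0) :=
        hu.contDiffAt.isSymmSndFDerivAt (by simp; norm_cast) _ _
      have hsv : fderiv ℝ (fderiv ℝ v) p (1, 0) (0, 1) = fderiv ℝ (fderiv ℝ v) p (0, 1) (1, 0) :=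
        hv.contDiffAt.isSymmSndFDerivAt (by simp; norm_cast) _ _
      rw [← h]
      simp only [add_apply, sub_apply, neg_apply, smul_apply,
        ContinuousLinearMap.flip_apply, smul_eq_mul, hsu, hsv]
      ring
  have hcont : Continuous fun p : ℝ × ℝ => n (u p ^ 2 + v p ^ 2) *
      (fderiv ℝ u p (1, 0) * fderiv ℝ v p (0, 1) -
        fderiv ℝ u p (0, 1) * fderiv ℝ v p (1, 0)) := by
    have := hu.continuous
    have := hv.continuous
    have := hu2.continuous
    have := hv2.continuous
    fun_prop
  have hD' : ∀ p, HasFDerivAt (fun p => -(K (u p ^ 2 + v p ^ 2) *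
      (u p * fderiv ℝ v p (1, 0) - v p * fderiv ℝ u p (1, 0)))) (-D (1, 0) p) p :=
    fun p => (hD (1, 0) p).fun_neg
  rw [← integral2_divergence_prod_of_hasFDerivAt_off_countable _ _ (D (0, 1))
    (fun p => -D (1, 0) p) a c b d ∅ countable_empty
    (fun p _ => (hD (0, 1) p).continuousAt.continuousWithinAt)
    (fun p _ => (hD' p).continuousAt.continuousWithinAt)
    (fun p _ => hD (0, 1) p) (fun p _ => hD' p) ?_]
  · simp only [hcurl]
  · simp only [hcurl]
    exact hcont.continuousOn.integrableOn_compact (isCompact_uIcc.prod isCompact_uIcc)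

/-! ### The Heinz integral over a disc -/

/-- A radial weight `Φ(|w|)` on the plane is, up to the factor `dw₁ ∧ dw₂`, the differential of
`K(|w|²) (w₁ dw₂ - w₂ dw₁)`; far from the origin this is a multiple of the angular form. -/
theorem exists_radial_primitive {Φ : ℝ → ℝ} {ε : ℝ} (hΦ : Continuous Φ)
    (hnear : ∃ a > 0, ∀ s ≤ a, Φ s = 0) (hfar : ∀ s ≥ ε, Φ s = 0) :
    ∃ (K K' : ℝ → ℝ) (κ : ℝ), (∀ x, HasDerivAt K (K' x) x) ∧
      (∀ x, 2 * (x * K' x) + 2 * K x = Φ √x) ∧ ∀ x ≥ ε ^ 2, K x * x = κ := by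
  obtain ⟨a, ha, hnear⟩ := hnear
  have hc : Continuous fun y => Φ √y / 2 := by fun_prop
  set N : ℝ → ℝ := fun x => ∫ y in (0 : ℝ)..x, Φ √y / 2 with hN
  have hN' : ∀ x, HasDerivAt N (Φ √x / 2) x := fun x =>
    intervalIntegral.integral_hasDerivAt_right (hc.intervalIntegrable _ _)
      (hc.stronglyMeasurableAtFilter _ _) hc.continuousAt
  have hsmall : ∀ x ≤ a ^ 2, Φ √x = 0 := fun x hx => hnear _ (sqrt_le_iff.2 ⟨ha.le, hx⟩)
  have hN0 : ∀ x ≤ a ^ 2, N x = 0 := by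
    intro x hx
    refine intervalIntegral.integral_zero_ae (Filter.Eventually.of_forall fun y hy => ?_)
    have : y ≤ a ^ 2 := hy.2.trans (max_le (by positivity) hx)
    simp [hsmall y this]
  refine ⟨fun x => N x / x, fun x => (Φ √x / 2 - N x / x) / x, N (ε ^ 2), fun x => ?_,
    fun x => ?_, fun x hx => ?_⟩
  · rcases eq_or_ne x 0 with rfl | hx
    · have : (fun x => N x / x) =ᶠ[nhds 0] fun _ => 0 := by
        filter_upwards [Iio_mem_nhds (show (0 : ℝ) < a ^ 2 by positivity)] with y hy
        simp [hN0 y (le_of_lt hy)]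
      simpa using (hasDerivAt_const (0 : ℝ) (0 : ℝ)).congr_of_eventuallyEq this
    · refine ((hN' x).div (hasDerivAt_id x) hx).congr_deriv ?_
      simp only [id]
      field_simp
  · rcases eq_or_ne x 0 with rfl | hx
    · simp [show Φ 0 = 0 from hnear 0 ha.le]
    · field_simp; ring
  · have hx' : N x = N (ε ^ 2) := by
      rw [← sub_eq_zero, hN]
      simp only
      rw [intervalIntegral.integral_interval_sub_left (hc.intervalIntegrable _ _)
        (hc.intervalIntegrable _ _)]
      refine intervalIntegral.integral_zero_ae (Filter.Eventually.of_forall fun y hy => ?_)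
      rw [uIoc_of_le hx] at hy
      simp [hfar _ (le_sqrt_of_sq_le hy.1.le)]
    rcases eq_or_ne x 0 with rfl | h0
    · rw [← hx', hN0 0 (by positivity)]; simp
    · rw [← hx']; field_simp

theorem fderiv_comp_polarPoint {g : Plane → Plane} (hg : ContDiff ℝ ∞ g) (i : Fin 2)
    (p w : ℝ × ℝ) :
    fderiv ℝ (fun p => g (polarPoint p) i) p w =
      fderiv ℝ g (polarPoint p) (fderiv ℝ polarPoint p w) i := by
  have h1 := ((contDiff_polarPoint.differentiable (by simp)) p).hasFDerivAt
  have h2 := ((hg.differentiable (by simp)) (polarPoint p)).hasFDerivAt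
  have h3 := (EuclideanSpace.proj (𝕜 := ℝ) i).hasFDerivAt.comp p (h2.comp p h1)
  have h4 : HasFDerivAt (fun p => g (polarPoint p) i) _ p := h3
  rw [h4.fderiv]; rfl

theorem Plane.norm_eq (x : Plane) : ‖x‖ = √(x 0 ^ 2 + x 1 ^ 2) := by
  simp [EuclideanSpace.norm_eq, Fin.sum_univ_two]

/-- The identification of the Euclidean plane with `ℂ`. -/
noncomputable def planeToComplex (x : Plane) : ℂ := x 0 + x 1 * Complex.I

theorem continuous_planeToComplex : Continuous planeToComplex := by
  unfold planeToComplex; fun_prop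

theorem norm_planeToComplex (x : Plane) : ‖planeToComplex x‖ = ‖x‖ := by
  rw [planeToComplex, Complex.norm_add_mul_I, Plane.norm_eq]

theorem planeToComplex_sub (x y : Plane) :
    planeToComplex (x - y) = planeToComplex x - planeToComplex y := by
  simp [planeToComplex]; ring

/-- The Heinz integral over a disc as an integral over its boundary circle. -/
theorem integral_ball_eq_integral_circle {g : Plane → Plane} (hg : ContDiff ℝ ∞ g)
    {Φ K K' : ℝ → ℝ} (hΦ : Continuous Φ) (hK : ∀ x, HasDerivAt K (K' x) x)
    (h : ∀ x, 2 * (x * K' x) + 2 * K x = Φ √x) {R : ℝ} (hR : 0 < R) :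
    ∫ x in Metric.ball (0 : Plane) R, Φ ‖g x‖ * (fderiv ℝ g x).det =
      ∫ θ in (-π)..π, K (g (polarPoint (R, θ)) 0 ^ 2 + g (polarPoint (R, θ)) 1 ^ 2) *
        (g (polarPoint (R, θ)) 0 * fderiv ℝ (fun p => g (polarPoint p) 1) (R, θ) (0, 1) -
          g (polarPoint (R, θ)) 1 * fderiv ℝ (fun p => g (polarPoint p) 0) (R, θ) (0, 1)) := by
  have hdet : Continuous fun x => (fderiv ℝ g x).det :=
    ContinuousLinearMap.continuous_det.comp (hg.continuous_fderiv (by simp))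
  have hgc := hg.continuous
  rw [setIntegral_ball_eq_polar (by fun_prop) hR]
  have hcomp : ∀ i : Fin 2, ContDiff ℝ ∞ fun p => g (polarPoint p) i := fun i =>
    (contDiff_euclidean.1 (hg.comp contDiff_polarPoint)) i
  have hG := integral_jacobian_rectangle (hcomp 0) (hcomp 1) hK (n := fun x => Φ √x)
    (by fun_prop) h 0 R (-π) π
  -- the two radial sides of the rectangle are glued, the side `ρ = 0` is collapsed to a point
  have hglue : ∀ ρ, polarPoint (ρ, -π) = polarPoint (ρ, π) := fun ρ => by simp [polarPoint]
  have hzero : ∀ θ : ℝ, !₂[-((0 : ℝ) * sin θ), 0 * cos θ] = (0 : Plane) := fun θ => by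
    ext i; fin_cases i <;> simp
  have hl : ∀ ρ, fderiv ℝ polarPoint (ρ, -π) (1, 0) = fderiv ℝ polarPoint (ρ, π) (1, 0) := by
    intro ρ; simp [fderiv_polarPoint_one_zero]
  have h0 : ∀ θ, fderiv ℝ polarPoint (0, θ) (0, 1) = 0 := fun θ => by
    rw [fderiv_polarPoint_zero_one]; exact hzero θ
  have hgl : ∀ (i : Fin 2) ρ, fderiv ℝ (fun p => g (polarPoint p) i) (ρ, -π) (1, 0) =
      fderiv ℝ (fun p => g (polarPoint p) i) (ρ, π) (1, 0) := fun i ρ => by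
    simp only [fderiv_comp_polarPoint hg, hl, hglue]
  have hg0 : ∀ (i : Fin 2) θ, fderiv ℝ (fun p => g (polarPoint p) i) (0, θ) (0, 1) = 0 :=
    fun i θ => by simp [fderiv_comp_polarPoint hg, h0]
  simp only [hgl, hglue, hg0, sub_self, mul_zero, intervalIntegral.integral_zero, zero_add,
    sub_zero] at hG
  rw [← hG]
  refine intervalIntegral.integral_congr fun ρ _ => intervalIntegral.integral_congr fun θ _ => ?_
  simp only [fderiv_comp_polarPoint hg, fderiv_polarPoint_one_zero, fderiv_polarPoint_zero_one]
  have hlin : ∀ x y : ℝ, (!₂[x, y] : Plane) = x • !₂[1, 0] + y • !₂[0, 1] := fun x y => by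
    ext i; fin_cases i <;> simp
  rw [Plane.det_eq, Plane.norm_eq, hlin (cos θ), hlin (-(ρ * sin θ))]
  simp only [map_add, map_smul, PiLp.add_apply, PiLp.smul_apply, smul_eq_mul]
  linear_combination (-(Φ √(g (polarPoint (ρ, θ)) 0 ^ 2 + g (polarPoint (ρ, θ)) 1 ^ 2) * ρ *
    (fderiv ℝ g (polarPoint (ρ, θ)) !₂[1, 0] 0 * fderiv ℝ g (polarPoint (ρ, θ)) !₂[0, 1] 1 -
      fderiv ℝ g (polarPoint (ρ, θ)) !₂[0, 1] 0 * fderiv ℝ g (polarPoint (ρ, θ)) !₂[1, 0] 1))) *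
    cos_sq_add_sin_sq θ

/-- The Heinz integral over a disc is proportional to the winding number of the image of the
boundary circle; the factor depends only on the weight. -/
theorem exists_integral_ball_eq_const_mul_winding {Φ : ℝ → ℝ} {ε : ℝ} (hΦ : Continuous Φ)
    (hε : 0 < ε) (hnear : ∃ a > 0, ∀ s ≤ a, Φ s = 0) (hfar : ∀ s ≥ ε, Φ s = 0) :
    ∃ κ : ℝ, ∀ (g : Plane → Plane) (R : ℝ) (n : ℤ), ContDiff ℝ ∞ g → 0 < R →
      (∀ θ, ε ≤ ‖g (polarPoint (R, θ))‖) →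
      HasWinding (fun θ => planeToComplex (g (polarPoint (R, θ)))) n →
      ∫ x in Metric.ball (0 : Plane) R, Φ ‖g x‖ * (fderiv ℝ g x).det = κ * n := by
  obtain ⟨K, K', κ, hK, hKΦ, hκ⟩ := exists_radial_primitive hΦ hnear hfar
  refine ⟨κ * (2 * π), fun g R n hg hR hge hw => ?_⟩
  rw [integral_ball_eq_integral_circle hg hΦ hK hKΦ hR]
  have hcomp : ∀ i : Fin 2, ContDiff ℝ ∞ fun p => g (polarPoint p) i := fun i =>
    (contDiff_euclidean.1 (hg.comp contDiff_polarPoint)) i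
  -- derivatives along the circle
  set d : Fin 2 → ℝ → ℝ := fun i θ => fderiv ℝ (fun p => g (polarPoint p) i) (R, θ) (0, 1) with hd
  have hdc : ∀ i, Continuous (d i) := fun i =>
    (((hcomp i).continuous_fderiv (by simp)).comp (by fun_prop : Continuous fun θ : ℝ => (R, θ)))
      |>.clm_apply continuous_const
  have hdd : ∀ i θ, HasDerivAt (fun θ => g (polarPoint (R, θ)) i) (d i θ) θ := fun i θ =>
    (((hcomp i).differentiable (by simp)) (R, θ)).hasFDerivAt.comp_hasDerivAt_of_eq θ
      ((hasDerivAt_const θ R).prodMk (hasDerivAt_id θ)) rfl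
  have hcd : ∀ θ, HasDerivAt (fun θ => planeToComplex (g (polarPoint (R, θ))))
      (d 0 θ + d 1 θ * Complex.I) θ := fun θ =>
    ((hdd 0 θ).ofReal_comp).add (((hdd 1 θ).ofReal_comp).mul_const _)
  have hcc : Continuous fun θ => (d 0 θ + d 1 θ * Complex.I : ℂ) := by
    have := hdc 0
    have := hdc 1
    fun_prop
  have hint := hw.integral_div hcd hcc
  have him := congrArg (fun z : ℂ => κ * z.im) hint
  have hii : IntervalIntegrable (fun θ => (d 0 θ + d 1 θ * Complex.I : ℂ) /
      planeToComplex (g (polarPoint (R, θ)))) volume (-π) π :=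
    (hcc.div hw.continuous hw.ne_zero).intervalIntegrable _ _
  rw [← Complex.imCLM_apply, ← ContinuousLinearMap.intervalIntegral_comp_comm _ hii,
    ← intervalIntegral.integral_const_mul] at him
  have hR' : κ * (2 * π * n * Complex.I : ℂ).im = κ * (2 * π) * n := by
    simp [mul_assoc]
  rw [← hR', ← him]
  refine intervalIntegral.integral_congr fun θ _ => ?_
  simp only [Complex.imCLM_apply]
  have hge' := hge θ
  rw [Plane.norm_eq] at hge'
  set x := g (polarPoint (R, θ)) 0 with hx
  set y := g (polarPoint (R, θ)) 1 with hy
  have hq : ε ^ 2 ≤ x ^ 2 + y ^ 2 := (le_sqrt hε.le (by positivity)).1 hge'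
  have hq0 : x ^ 2 + y ^ 2 ≠ 0 := (lt_of_lt_of_le (by positivity) hq).ne'
  rw [← hκ _ hq, planeToComplex, ← hx, ← hy, Complex.div_im, Complex.normSq_apply]
  simp only [Complex.add_re, Complex.add_im, Complex.mul_re, Complex.mul_im, Complex.ofReal_re,
    Complex.ofReal_im, Complex.I_re, Complex.I_im]
  ring_nf
  ring_nf at hq0
  field_simp
  ring

/-- The Heinz integral of a normalised weight is the winding number of the image of the
boundary circle. -/
theorem integral_ball_eq_winding {Φ : ℝ → ℝ} {ε : ℝ} (hΦ : Continuous Φ)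
    (hε : 0 < ε) (hnear : ∃ a > 0, ∀ s ≤ a, Φ s = 0) (hfar : ∀ s ≥ ε, Φ s = 0)
    (hmass : ∫ w : Plane, Φ ‖w‖ = 1) {g : Plane → Plane} {R : ℝ} {n : ℤ} (hg : ContDiff ℝ ∞ g)
    (hR : 0 < R) (hge : ∀ θ, ε ≤ ‖g (polarPoint (R, θ))‖)
    (hw : HasWinding (fun θ => planeToComplex (g (polarPoint (R, θ)))) n) :
    ∫ x in Metric.ball (0 : Plane) R, Φ ‖g x‖ * (fderiv ℝ g x).det = n := by
  obtain ⟨κ, hκ⟩ := exists_integral_ball_eq_const_mul_winding hΦ hε hnear hfar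
  have hp : ∀ θ, planeToComplex (polarPoint (ε, θ)) =
      ε * Complex.exp ((1 : ℤ) * θ * Complex.I) := fun θ => by
    simp [planeToComplex, polarPoint, Complex.exp_mul_I]; ring
  have h1 : HasWinding (fun θ => planeToComplex (polarPoint (ε, θ))) 1 := by
    simp only [hp]
    exact (HasWinding.exp_int_mul 1).const_mul (by exact_mod_cast hε.ne')
  have h2 : ∀ θ, ε ≤ ‖polarPoint (ε, θ)‖ := fun θ => by
    rw [← norm_planeToComplex, hp, norm_mul, Complex.norm_exp]
    simp [abs_of_pos hε]
  -- the mass of the weight is its Heinz integral for the identity map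
  have h3 := hκ id ε 1 contDiff_id hε h2 h1
  have h4 : ∫ x in Metric.ball (0 : Plane) ε, Φ ‖x‖ = 1 := by
    rw [← hmass]
    refine setIntegral_eq_integral_of_forall_compl_eq_zero fun x hx => hfar _ ?_
    simpa using hx
  have h5 : (ContinuousLinearMap.id ℝ Plane).det = 1 := LinearMap.det_id
  simp only [id, fderiv_id, h5, mul_one, h4, Int.cast_one] at h3
  rw [hκ g R n hg hR hge hw, ← h3, one_mul]

/-! ### The degree on a disc and at a fixed radius -/

/-- A normalised Heinz weight supported in an annulus of outer radius `ε`. -/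
theorem exists_heinz_weight {ε : ℝ} (hε : 0 < ε) :
    ∃ Φ : ℝ → ℝ, Continuous Φ ∧ (∃ a > 0, ∀ s ≤ a, Φ s = 0) ∧ (∀ s ≥ ε, Φ s = 0) ∧
      ∫ w : Plane, Φ ‖w‖ = 1 := by
  set Φ : ℝ → ℝ := fun s => max 0 (min (s - ε / 2) (ε - s)) with hΦ
  have hc : Continuous Φ := by fun_prop
  have h0 : ∀ s, 0 ≤ Φ s := fun s => le_max_left _ _
  have hnear : ∀ s ≤ ε / 2, Φ s = 0 := fun s hs =>
    max_eq_left ((min_le_left _ _).trans (by linarith))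
  have hfar : ∀ s ≥ ε, Φ s = 0 := fun s hs =>
    max_eq_left ((min_le_right _ _).trans (by linarith))
  have hpos : 0 < ∫ w : Plane, Φ ‖w‖ := by
    have hcn : Continuous fun w : Plane => Φ ‖w‖ := by fun_prop
    have hcs : HasCompactSupport fun w : Plane => Φ ‖w‖ :=
      HasCompactSupport.intro (isCompact_closedBall (0 : Plane) ε) fun w hw =>
        hfar _ (by simpa using (not_le.1 (by simpa using hw)).le)
    refine hcn.integral_pos_of_hasCompactSupport_nonneg_nonzero hcs (fun w => h0 _)
      (x := !₂[3 * ε / 4, 0]) ?_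
    have : ‖(!₂[3 * ε / 4, 0] : Plane)‖ = 3 * ε / 4 := by
      rw [Plane.norm_eq]
      simp [sqrt_sq (show 0 ≤ 3 * ε / 4 by positivity)]
    rw [this]
    refine ne_of_gt (lt_max_of_lt_right (lt_min ?_ ?_)) <;> linarith
  refine ⟨fun s => (∫ w : Plane, Φ ‖w‖)⁻¹ * Φ s, by fun_prop, ⟨ε / 2, by positivity, fun s hs => ?_⟩,
    fun s hs => ?_, ?_⟩
  · simp [hnear s hs]
  · simp [hfar s hs]
  · rw [integral_const_mul, inv_mul_cancel₀ hpos.ne']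

theorem polarPoint_mem_sphere {r : ℝ} (hr : 0 ≤ r) (θ : ℝ) :
    polarPoint (r, θ) ∈ Metric.sphere (0 : Plane) r := by
  rw [mem_sphere_zero_iff_norm, Plane.norm_eq, ← sqrt_sq hr]
  congr 1
  simp [polarPoint, sqrt_sq hr]
  linear_combination r ^ 2 * cos_sq_add_sin_sq θ

theorem exists_polarPoint_eq (x : Plane) : ∃ θ ∈ Icc (-π) π, polarPoint (‖x‖, θ) = x := by
  refine ⟨(planeToComplex x).arg, ⟨(Complex.neg_pi_lt_arg _).le, Complex.arg_le_pi _⟩, ?_⟩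
  have h := Complex.norm_mul_exp_arg_mul_I (planeToComplex x)
  rw [norm_planeToComplex, Complex.exp_mul_I] at h
  have h1 := congrArg Complex.re h
  have h2 := congrArg Complex.im h
  simp [planeToComplex, -Complex.norm_mul_cos_add_sin_mul_I, ← Complex.ofReal_cos,
    ← Complex.ofReal_sin] at h1 h2
  ext i
  fin_cases i
  · simpa [polarPoint, planeToComplex] using h1
  · simpa [polarPoint, planeToComplex] using h2

/-- The Brouwer degree on a disc is the winding number of the image of the boundary circle. -/
theorem hasBrouwerDegree_ball_of_hasWinding {f : Plane → Plane} (hf : Continuous f) {r : ℝ}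
    (hr : 0 < r) {n : ℤ}
    (hw : HasWinding (fun θ => planeToComplex (f (polarPoint (r, θ)))) n) :
    HasBrouwerDegree f (Metric.ball 0 r) 0 n := by
  have hfr : frontier (Metric.ball (0 : Plane) r) = Metric.sphere 0 r := frontier_ball _ hr.ne'
  have hne : ∀ x ∈ Metric.sphere (0 : Plane) r, f x ≠ 0 := by
    intro x hx h0
    obtain ⟨θ, -, hθ⟩ := exists_polarPoint_eq x
    rw [mem_sphere_zero_iff_norm.1 hx] at hθ
    apply hw.ne_zero θ
    simp [hθ, h0, planeToComplex]
  refine ⟨Metric.isOpen_ball, Metric.isBounded_ball, hf.continuousOn, by rwa [hfr], ?_, ?_⟩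
  · obtain ⟨δ, hδ, hδf⟩ := (isCompact_sphere (0 : Plane) r).exists_forall_le'
      (f := fun x => ‖f x‖) (by fun_prop) (a := 0) fun x hx => norm_pos_iff.2 (hne x hx)
    have hε : 0 < δ / 2 := by positivity
    obtain ⟨g, hg, hgf, -⟩ := hf.exists_contDiff_approx (ε := fun _ => δ / 2) ⊤ continuous_const
      fun _ => hε
    obtain ⟨Φ, h1, h2, h3, h4⟩ := exists_heinz_weight hε
    refine ⟨g, Φ, δ / 2, hε, fun x hx => ?_, hg, fun x _ => ?_, h1, h2, h3, h4⟩
    · rw [hfr] at hx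
      simpa using by linarith [hδf x hx]
    · rw [← dist_eq_norm]; exact hgf x
  · intro g Φ ε H
    have hge : ∀ θ, ‖g (polarPoint (r, θ)) - f (polarPoint (r, θ))‖ < ε ∧
        2 * ε ≤ ‖f (polarPoint (r, θ))‖ := fun θ => by
      have hs := polarPoint_mem_sphere hr.le θ
      refine ⟨H.close _ ?_, ?_⟩
      · rw [closure_ball _ hr.ne']; exact Metric.sphere_subset_closedBall hs
      · simpa using H.sep (polarPoint (r, θ)) (by rwa [hfr])
    have hgc : Continuous fun θ => planeToComplex (g (polarPoint (r, θ))) :=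
      continuous_planeToComplex.comp (H.smooth.continuous.comp
        (contDiff_polarPoint.continuous.comp (by fun_prop)))
    simp only [sub_zero]
    refine integral_ball_eq_winding H.weight_cont H.pos H.weight_near H.weight_far H.weight_mass
      H.smooth hr (fun θ => ?_) (hw.of_div_mem_slitPlane hgc (fun θ => by simp [polarPoint]) ?_)
    · have := norm_sub_norm_le (f (polarPoint (r, θ))) (g (polarPoint (r, θ)))
      rw [norm_sub_rev] at this
      linarith [hge θ]
    · intro θ
      have h0 := hw.ne_zero θ
      have h1 : ‖(planeToComplex (g (polarPoint (r, θ))) - planeToComplex (f (polarPoint (r, θ)))) /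
          planeToComplex (f (polarPoint (r, θ)))‖ < 1 := by
        rw [norm_div, ← planeToComplex_sub, norm_planeToComplex, norm_planeToComplex, div_lt_one]
        · linarith [hge θ, H.pos]
        · linarith [hge θ, H.pos]
      have h2 := Complex.mem_slitPlane_of_norm_lt_one h1
      rwa [sub_div, div_self h0, add_sub_cancel] at h2

theorem polarProj_eq_polarPoint (φ r : ℝ) : polarProj φ r = polarPoint (r, -φ) := by
  simp [polarProj, polarPoint]

/-- Clockwise polar coordinates make the closed half-plane `ℝ × [0, ∞)` a quotient map onto the
plane: maps of the plane are continuous if they are so in polar coordinates. -/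
theorem continuous_of_continuousOn_polarProj {h : Plane → Plane}
    (hh : ContinuousOn (fun p : ℝ × ℝ => h (polarProj p.1 p.2)) (univ ×ˢ Ici 0)) :
    Continuous h := by
  have key : ∀ R, ContinuousOn h (Metric.closedBall 0 R) := by
    intro R
    rw [continuousOn_iff_isClosed]
    intro C hC
    have hS : IsCompact (Icc (-π) π ×ˢ Icc 0 R : Set (ℝ × ℝ)) := isCompact_Icc.prod isCompact_Icc
    have hcl := (hh.mono (prod_mono (subset_univ (Icc (-π) π))
      (Icc_subset_Ici_self : Icc 0 R ⊆ Ici 0))).preimage_isClosed_of_isClosed hS.isClosed hC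
    have hproj : Continuous fun p : ℝ × ℝ => polarProj p.1 p.2 := by
      simp only [polarProj_eq_polarPoint]
      exact contDiff_polarPoint.continuous.comp (by fun_prop)
    refine ⟨_, ((hS.of_isClosed_subset hcl inter_subset_left).image hproj).isClosed, ?_⟩
    ext x
    refine ⟨fun hx => ⟨?_, hx.2⟩, ?_⟩
    · obtain ⟨θ, hθ, hx'⟩ := exists_polarPoint_eq x
      have hx2 : polarProj (-θ) ‖x‖ = x := by rw [polarProj_eq_polarPoint, neg_neg, hx']
      refine ⟨(-θ, ‖x‖), ⟨⟨⟨by linarith [hθ.2], by linarith [hθ.1]⟩, norm_nonneg x, ?_⟩, ?_⟩, hx2⟩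
      · simpa using hx.2
      · simpa only [mem_preimage, hx2] using hx.1
    · rintro ⟨⟨p, hp, rfl⟩, hx⟩
      exact ⟨hp.2, hx⟩
  exact continuous_iff_continuousAt.2 fun x => (key (‖x‖ + 1)).continuousAt
    (Metric.closedBall_mem_nhds_of_mem (by simp))

/-- The degree at a fixed radius is the negative of the winding number of the angular loop: the
polar coordinates run clockwise. -/
theorem hasFixedRadiusDegree_of_hasWinding {f : ℝ → ℝ → Plane}
    (hf : ContinuousOn (fun p : ℝ × ℝ => f p.1 p.2) (univ ×ˢ Ioi 0)) {r : ℝ} (hr : 0 < r) {n : ℤ}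
    (hw : HasWinding (fun φ => planeToComplex (f φ r)) n) :
    HasFixedRadiusDegree f r (-n) := by
  have hinj : ∀ x y : Plane, planeToComplex x = planeToComplex y → x = y := fun x y hxy => by
    rw [← sub_eq_zero, ← norm_eq_zero, ← norm_planeToComplex, planeToComplex_sub, hxy, sub_self,
      norm_zero]
  have hper : ∀ φ, f (φ + 2 * π) r = f φ r := fun φ => hinj _ _ (hw.periodic φ)
  have hfc : Continuous fun φ => f φ r :=
    (hf.comp_continuous (f := fun φ : ℝ => (φ, r)) (by fun_prop) fun φ => ⟨trivial, hr⟩)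
  refine ⟨hf, ?_, ?_⟩
  · -- the conical extension `(ρ / r) f(φ, r)`
    have hang : ∀ x : Plane, ∃ θ, polarPoint (‖x‖, θ) = x := fun x =>
      (exists_polarPoint_eq x).imp fun _ h => h.2
    choose α hα using hang
    refine ⟨fun x => (‖x‖ / r) • f (-α x) r, fun φ ρ => (ρ / r) • f φ r,
      ⟨Continuous.continuousOn (by fun_prop), fun φ ρ _ => by simp only [hper],
        fun φ => by simp, fun φ => by simp [hr.ne']⟩, fun φ ρ hρ => ?_⟩
    have hn : ‖polarProj φ ρ‖ = ρ := by
      rw [polarProj_eq_polarPoint]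
      exact mem_sphere_zero_iff_norm.1 (polarPoint_mem_sphere hρ _)
    simp only [hn]
    rcases hρ.eq_or_lt with rfl | hρ
    · simp
    have h := hα (polarProj φ ρ)
    rw [hn, polarProj_eq_polarPoint] at h
    have h1 := congrFun (congrArg WithLp.ofLp h) 0
    have h2 := congrFun (congrArg WithLp.ofLp h) 1
    simp only [polarPoint, Matrix.cons_val_zero, Matrix.cons_val_one, mul_right_inj' hρ.ne'] at h1 h2
    have h3 : ((α (polarPoint (ρ, -φ)) : ℝ) : Real.Angle) = ((-φ : ℝ) : Real.Angle) :=
      Real.Angle.cos_sin_inj h1 h2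
    obtain ⟨k, hk⟩ := Real.Angle.angle_eq_iff_two_pi_dvd_sub.1 h3
    have hp : Function.Periodic (fun φ => f φ r) (2 * π) := hper
    rw [polarProj_eq_polarPoint, show -α (polarPoint (ρ, -φ)) = φ - k * (2 * π) by linarith]
    exact congrArg _ (hp.sub_int_mul_eq k)
  · rintro h ⟨fr, hfr, hh⟩
    have hcont : Continuous h := continuous_of_continuousOn_polarProj
      (hfr.cont.congr fun p hp => hh p.1 p.2 hp.2)
    refine hasBrouwerDegree_ball_of_hasWinding hcont hr ?_
    convert hw.comp_neg using 3 with θ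
    rw [← hfr.at_radius, ← hh _ _ hr.le, polarProj_eq_polarPoint, neg_neg]

/-! ### Existence of the Maslov index -/

theorem det_hypMat_mul_rotMat (τ σ θ : ℝ) : (hypMat τ σ * rotMat θ).det = 1 := by
  have h1 : (hypMat τ σ).det = 1 := by
    rw [hypMat, Matrix.det_fin_two_of]
    linear_combination cosh_sq_sub_sinh_sq τ - sinh τ ^ 2 * cos_sq_add_sin_sq σ
  have h2 : (rotMat θ).det = 1 := by
    rw [rotMat, Matrix.det_fin_two_of]
    linear_combination cos_sq_add_sin_sq θ
  rw [Matrix.det_mul, h1, h2, one_mul]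

/-- Resonance in terms of the decomposition into a hyperbolic and a circular rotation. -/
theorem det_one_sub_hypMat_mul_rotMat (τ σ θ : ℝ) :
    (1 - hypMat τ σ * rotMat θ).det = 2 * (1 - cosh τ * cos θ) := by
  have h := det_hypMat_mul_rotMat τ σ θ
  have htr : (hypMat τ σ * rotMat θ) 0 0 + (hypMat τ σ * rotMat θ) 1 1 = 2 * (cosh τ * cos θ) := by
    simp [hypMat, rotMat, Matrix.mul_apply, Fin.sum_univ_two]; ring
  rw [Matrix.det_fin_two] at h ⊢
  simp only [Matrix.sub_apply, Matrix.one_apply_eq, Matrix.one_apply_ne (zero_ne_one' (Fin 2)),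
    Matrix.one_apply_ne (zero_ne_one' (Fin 2)).symm]
  linear_combination h - htr

/-- The angle of the rotation factor of a matrix `A` in `SL(2, ℝ)` is the argument of
`(A₀₀ + A₁₁) + i (A₀₁ - A₁₀)`. -/
theorem exists_eq_hypMat_mul_rotMat {A : Mat2} (hdet : A.det = 1) {θ : ℝ}
    (hs : (A 0 0 + A 1 1) * sin θ = (A 0 1 - A 1 0) * cos θ)
    (hpos : 0 < (A 0 0 + A 1 1) * cos θ + (A 0 1 - A 1 0) * sin θ) :
    ∃ τ σ : ℝ, 0 ≤ τ ∧ A = hypMat τ σ * rotMat θ := by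
  rw [Matrix.det_fin_two] at hdet
  have hcs := cos_sq_add_sin_sq θ
  -- the entries of the symmetric matrix `A * rotMat (-θ)`
  obtain ⟨w, hw⟩ : ∃ w, w = ((A 0 0 + A 1 1) * cos θ + (A 0 1 - A 1 0) * sin θ) / 2 := ⟨_, rfl⟩
  obtain ⟨X, hX⟩ : ∃ X, X = ((A 0 0 - A 1 1) * cos θ + (A 0 1 + A 1 0) * sin θ) / 2 := ⟨_, rfl⟩
  obtain ⟨Y, hY⟩ : ∃ Y, Y = A 0 1 * cos θ - A 0 0 * sin θ := ⟨_, rfl⟩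
  have hY' : Y = A 1 0 * cos θ + A 1 1 * sin θ := by rw [hY]; linear_combination -hs
  have hw0 : 0 < w := by rw [hw]; linarith
  have h1 : w ^ 2 = 1 + (X ^ 2 + Y ^ 2) := by
    have : Y ^ 2 = (A 0 1 * cos θ - A 0 0 * sin θ) * (A 1 0 * cos θ + A 1 1 * sin θ) := by
      rw [sq]; nth_rw 1 [hY]; rw [hY']
    rw [this, hw, hX]
    linear_combination (cos θ ^ 2 + sin θ ^ 2) * hdet + hcs
  set z : ℂ := ⟨X, Y⟩ with hz
  have hzn : ‖z‖ ^ 2 = X ^ 2 + Y ^ 2 := by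
    rw [Complex.sq_norm, Complex.normSq_apply]; simp only [hz]; ring
  have hsh : sinh (arsinh ‖z‖) = ‖z‖ := sinh_arsinh _
  have hch : cosh (arsinh ‖z‖) = w := by
    rw [cosh_arsinh, hzn, ← h1, sqrt_sq hw0.le]
  have hc : ‖z‖ * cos z.arg = X := Complex.norm_mul_cos_arg z
  have hs' : ‖z‖ * sin z.arg = Y := Complex.norm_mul_sin_arg z
  refine ⟨arsinh ‖z‖, z.arg, arsinh_nonneg_iff.2 (norm_nonneg _), ?_⟩
  rw [hypMat, hsh, hch, hc, hs', rotMat]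
  ext i j
  fin_cases i <;> fin_cases j <;> simp [Matrix.mul_apply, Fin.sum_univ_two]
  · rw [hw, hX, hY]; linear_combination -A 0 0 * hcs
  · rw [hw, hX, hY]; linear_combination -A 0 1 * hcs
  · rw [hw, hX, hY']; linear_combination -A 1 0 * hcs
  · rw [hw, hX, hY']; linear_combination -A 1 1 * hcs

theorem exists_int_abs_sub_lt_of_cos_pos {x : ℝ} (h : 0 < cos x) :
    ∃ k : ℤ, |x - k * (2 * π)| < π / 2 := by
  refine ⟨round (x / (2 * π)), ?_⟩
  have h1 := abs_sub_round (x / (2 * π))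
  have h2 : |x - round (x / (2 * π)) * (2 * π)| ≤ π := by
    have : x - round (x / (2 * π)) * (2 * π) = (x / (2 * π) - round (x / (2 * π))) * (2 * π) := by
      field_simp
    rw [this, abs_mul, abs_of_pos two_pi_pos]
    nlinarith [pi_pos]
  by_contra! h3
  have h4 := cos_nonpos_of_pi_div_two_le_of_le h3 (by linarith [pi_pos])
  rw [cos_abs, cos_sub_int_mul_two_pi] at h4
  linarith

theorem continuousOn_ite_le {X : Type*} [TopologicalSpace X] {f g : ℝ → X} {a b c : ℝ}
    (hf : ContinuousOn f (Icc a b)) (hg : ContinuousOn g (Icc b c)) (hab : a ≤ b) (hbc : b ≤ c)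
    (h : f b = g b) : ContinuousOn (fun t => if t ≤ b then f t else g t) (Icc a c) := by
  rw [← Icc_union_Icc_eq_Icc hab hbc]
  refine ContinuousOn.union_of_isClosed (hf.congr fun t ht => if_pos ht.2)
    (hg.congr fun t ht => ?_) isClosed_Icc isClosed_Icc
  rcases ht.1.eq_or_lt with rfl | hlt
  · simp [h]
  · simp [not_le.2 hlt]

/-- A non-resonant extension given by continuous parameters of the decomposition computes the
Maslov index. -/
theorem isMaslovIndex_of_extension {Ψ : ℝ → Mat2} {T : ℝ} (hT : 0 < T)
    (hc : ContinuousOn Ψ (Icc 0 T)) {θ : ℝ → ℝ} (hθ : ContinuousOn θ (Icc 0 T)) (hθ0 : θ 0 = 0)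
    (hdec : ∀ t ∈ Icc 0 T, ∃ τ σ : ℝ, 0 ≤ τ ∧ Ψ t = hypMat τ σ * rotMat (θ t))
    {τ σ ϑ : ℝ → ℝ} (hτ : Continuous τ) (hσ : Continuous σ) (hϑ : Continuous ϑ)
    (hΨT : Ψ T = hypMat (τ 0) (σ 0) * rotMat (ϑ 0)) (hϑ0 : ϑ 0 = θ T)
    (hτ0 : ∀ s ∈ Icc (0 : ℝ) 1, 0 ≤ τ s) (hres : ∀ s ∈ Icc (0 : ℝ) 1, cosh (τ s) * cos (ϑ s) ≠ 1)
    (hend1 : 0 < (1 - Ψ T).det → hypMat (τ 1) (σ 1) * rotMat (ϑ 1) = -1)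
    (hend2 : (1 - Ψ T).det < 0 → hypMat (τ 1) (σ 1) * rotMat (ϑ 1) = !![2, 0; 0, 1 / 2])
    {i : ℤ} (hi : ϑ 1 = -(i * π)) : IsMaslovIndex Ψ T i := by
  have hmat : Continuous fun t => hypMat (τ (t - T)) (σ (t - T)) * rotMat (ϑ (t - T)) := by
    refine Continuous.matrix_mul ?_ ?_ <;>
    · refine continuous_matrix fun i j => ?_
      fin_cases i <;> fin_cases j <;> simp [hypMat, rotMat] <;> fun_prop
  have hlast : ¬ T + 1 ≤ T := by linarith
  have hmem : ∀ t ∈ Icc T (T + 1), t - T ∈ Icc (0 : ℝ) 1 := fun t ht =>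
    ⟨by linarith [ht.1], by linarith [ht.2]⟩
  have hE : ∀ t ∈ Icc T (T + 1), (if t ≤ T then Ψ t else
      hypMat (τ (t - T)) (σ (t - T)) * rotMat (ϑ (t - T))) =
      hypMat (τ (t - T)) (σ (t - T)) * rotMat (ϑ (t - T)) := by
    intro t ht
    rcases ht.1.eq_or_lt with rfl | hlt
    · simp [hΨT]
    · simp [not_le.2 hlt]
  refine ⟨fun t => if t ≤ T then Ψ t else hypMat (τ (t - T)) (σ (t - T)) * rotMat (ϑ (t - T)),
    fun t => if t ≤ T then θ t else ϑ (t - T),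
    continuousOn_ite_le hc hmat.continuousOn hT.le (by linarith) (by simp [hΨT]),
    fun t ht => if_pos ht.2, fun t ht => ?_, fun h => ?_, fun h => ?_,
    continuousOn_ite_le hθ (by fun_prop) hT.le (by linarith) (by simp [hϑ0]),
    by simp [hT.le, hθ0], fun t ht => ?_, by simp [hlast, hi]⟩
  · simp only [hE t ht, det_one_sub_hypMat_mul_rotMat]
    intro h
    exact hres _ (hmem t ht) (by linarith)
  · simpa [hlast] using hend1 h
  · simpa [hlast] using hend2 h
  · by_cases h : t ≤ T
    · simpa only [h, if_true] using hdec t ⟨ht.1, h⟩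
    · simp only [h, if_false]
      exact ⟨_, _, hτ0 _ (hmem t ⟨(not_le.1 h).le, ht.2⟩), rfl⟩

/-- A path in `SL(2, ℝ)` with non-resonant end point has a Maslov index. -/
theorem exists_isMaslovIndex_of_angle {Ψ : ℝ → Mat2} {T : ℝ} (hT : 0 < T)
    (hc : ContinuousOn Ψ (Icc 0 T)) {θ : ℝ → ℝ} (hθ : ContinuousOn θ (Icc 0 T)) (hθ0 : θ 0 = 0)
    (hdec : ∀ t ∈ Icc 0 T, ∃ τ σ : ℝ, 0 ≤ τ ∧ Ψ t = hypMat τ σ * rotMat (θ t))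
    (hnonres : (1 - Ψ T).det ≠ 0) : ∃ i, IsMaslovIndex Ψ T i := by
  obtain ⟨τ₀, σ₀, hτ₀, hΨT⟩ := hdec T ⟨hT.le, le_rfl⟩
  have hdet := det_one_sub_hypMat_mul_rotMat τ₀ σ₀ (θ T)
  rw [← hΨT] at hdet
  rcases hnonres.lt_or_gt with hneg | hpos
  · -- In the coordinates `sinh τ` and `tan θ` the region `cosh τ cos θ > 1` is the convex cone
    -- `|tan θ| < sinh τ`; a segment in it leads to `diag (2, 1/2)`.
    have h1 : 1 < cosh τ₀ * cos (θ T) := by linarith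
    have hcos : 0 < cos (θ T) := by
      by_contra! h; nlinarith [cosh_pos τ₀]
    obtain ⟨k, hk⟩ := exists_int_abs_sub_lt_of_cos_pos hcos
    set θ' := θ T - k * (2 * π) with hθ'
    have hcos' : cos θ' = cos (θ T) := cos_sub_int_mul_two_pi _ _
    have hθT : k * (2 * π) + arctan (tan θ') = θ T := by
      rw [arctan_tan (neg_lt_of_abs_lt hk) (lt_of_abs_lt hk), hθ']; ring
    have hcone : |tan θ'| < sinh τ₀ := by
      refine abs_lt_of_sq_lt_sq ?_ (sinh_nonneg_iff.2 hτ₀)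
      have h2 := cosh_sq τ₀
      have h3 : tan θ' ^ 2 = 1 / cos θ' ^ 2 - 1 := by
        rw [tan_eq_sin_div_cos, div_pow, sin_sq, hcos']; field_simp
      have h4 : 1 / cos θ' ^ 2 < cosh τ₀ ^ 2 := by
        rw [hcos', div_lt_iff₀ (by positivity), ← mul_pow]
        exact one_lt_pow₀ h1 two_ne_zero
      linarith
    have hx0 : ∀ s ∈ Icc (0 : ℝ) 1, |(1 - s) * tan θ'| < (1 - s) * sinh τ₀ + s * (3 / 4) := by
      intro s hs
      rw [abs_mul, abs_of_nonneg (by linarith [hs.2] : 0 ≤ 1 - s)]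
      rcases hs.1.eq_or_lt with rfl | hs0
      · simpa using hcone
      · have := mul_le_mul_of_nonneg_left hcone.le (by linarith [hs.2] : 0 ≤ 1 - s)
        linarith
    refine ⟨-(2 * k), isMaslovIndex_of_extension hT hc hθ hθ0 hdec
      (τ := fun s => arsinh ((1 - s) * sinh τ₀ + s * (3 / 4))) (σ := fun s => (1 - s) * σ₀)
      (ϑ := fun s => k * (2 * π) + arctan ((1 - s) * tan θ'))
      ?_ (by fun_prop) ?_ ?_ ?_ ?_ ?_ (fun h => absurd h hneg.not_gt) (fun _ => ?_) ?_⟩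
    · exact continuous_arsinh.comp (by fun_prop)
    · exact continuous_const.add (continuous_arctan.comp (by fun_prop))
    · simp [hΨT, hθT]
    · simp [hθT]
    · intro s hs
      exact arsinh_nonneg_iff.2 ((abs_nonneg _).trans (hx0 s hs).le)
    · intro s hs
      have h5 : √(1 + ((1 - s) * tan θ') ^ 2) < √(1 + ((1 - s) * sinh τ₀ + s * (3 / 4)) ^ 2) := by
        refine sqrt_lt_sqrt (by positivity) ?_
        have := sq_lt_sq' (neg_lt_of_abs_lt ((abs_abs _).trans_lt (hx0 s hs)))
          (lt_of_abs_lt ((abs_abs _).trans_lt (hx0 s hs)))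
        rw [sq_abs] at this
        linarith
      rw [add_comm (k * (2 * π)), cos_add_int_mul_two_pi, cosh_arsinh, cos_arctan, mul_one_div]
      exact ((one_lt_div (by positivity)).2 h5).ne'
    · have h6 : √(1 + (3 / 4 : ℝ) ^ 2) = 5 / 4 := by
        rw [show (1 + (3 / 4) ^ 2 : ℝ) = (5 / 4) ^ 2 by norm_num, sqrt_sq (by norm_num)]
      simp only [sub_self, zero_mul, one_mul, zero_add, arctan_zero, add_zero, hypMat, rotMat,
        cosh_arsinh, sinh_arsinh, h6, cos_zero, sin_zero]
      have h7 := cos_int_mul_two_pi k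
      have h8 : sin (k * (2 * π)) = 0 := by simpa using sin_add_int_mul_two_pi 0 k
      rw [h7, h8]
      ext i j
      fin_cases i <;> fin_cases j <;> simp [Matrix.mul_apply, Fin.sum_univ_two] <;> norm_num
    · simp; ring
  · -- In the region `cosh τ cos θ < 1` both factors are moved towards `τ = 0`, `cos θ = -1`.
    have h1 : cosh τ₀ * cos (θ T) < 1 := by linarith
    obtain ⟨k, x, hx, hθT⟩ : ∃ (k : ℤ) (x : ℝ), |x| ≤ π ∧ θ T = (2 * k + 1) * π + x := by
      refine ⟨round ((θ T - π) / (2 * π)), _, ?_, (add_sub_cancel _ _).symm⟩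
      have h2 := abs_sub_round ((θ T - π) / (2 * π))
      have : θ T - (2 * round ((θ T - π) / (2 * π)) + 1) * π =
          ((θ T - π) / (2 * π) - round ((θ T - π) / (2 * π))) * (2 * π) := by
        field_simp; ring
      rw [this, abs_mul, abs_of_pos two_pi_pos]
      nlinarith [pi_pos]
    have hcos : ∀ y, cos ((2 * k + 1) * π + y) = -cos y := by
      intro y
      rw [show (2 * k + 1) * π + y = y + π + k * (2 * π) by ring, cos_add_int_mul_two_pi,
        cos_add_pi]
    rw [hθT, hcos] at h1
    refine ⟨-(2 * k + 1), isMaslovIndex_of_extension hT hc hθ hθ0 hdec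
      (τ := fun s => (1 - s) * τ₀) (σ := fun _ => σ₀) (ϑ := fun s => (2 * k + 1) * π + (1 - s) * x)
      (by fun_prop) (by fun_prop) (by fun_prop) (by simp [hΨT, hθT]) (by simp [hθT])
      (fun s hs => mul_nonneg (by linarith [hs.2]) hτ₀) (fun s hs => ne_of_lt ?_) (fun _ => ?_)
      (fun h => absurd h hpos.not_gt) ?_⟩
    · have hs1 : 0 ≤ 1 - s := by linarith [hs.2]
      have hs2 : 1 - s ≤ 1 := by linarith [hs.1]
      rw [hcos]
      have h2 : cosh ((1 - s) * τ₀) ≤ cosh τ₀ := by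
        rw [cosh_le_cosh, abs_mul, abs_of_nonneg hs1]
        exact mul_le_of_le_one_left (abs_nonneg _) hs2
      have h3 : cos x ≤ cos ((1 - s) * x) := by
        rw [← cos_abs x, ← cos_abs ((1 - s) * x), abs_mul, abs_of_nonneg hs1]
        exact cos_le_cos_of_nonneg_of_le_pi (by positivity) hx
          (mul_le_of_le_one_left (abs_nonneg _) hs2)
      have h4 := cosh_pos ((1 - s) * τ₀)
      rcases le_or_gt 0 (cos ((1 - s) * x)) with h5 | h5
      · nlinarith
      · nlinarith
    · have h2 := hcos 0
      have h3 : sin ((2 * k + 1) * π + 0) = 0 := by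
        rw [add_zero]
        exact_mod_cast sin_int_mul_pi (2 * k + 1)
      simp only [sub_self, zero_mul, hypMat, rotMat, h2, h3]
      ext i j
      fin_cases i <;> fin_cases j <;> simp [Matrix.mul_apply, Fin.sum_univ_two]
    · push_cast; ring

theorem IsFundamentalMatrix.continuousOn {L : ℝ → Mat2} {T : ℝ} {Ψ : ℝ → Mat2}
    (hΨ : IsFundamentalMatrix L T Ψ) : ContinuousOn Ψ (Icc 0 T) :=
  continuousOn_pi.2 fun i => continuousOn_pi.2 fun j => fun t ht =>
    (hΨ.2 t ht i j).continuousWithinAt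

/-- Liouville's formula: `J L(t)` has trace zero. -/
theorem IsFundamentalMatrix.det_eq_one {L : ℝ → Mat2} {T : ℝ} {Ψ : ℝ → Mat2}
    (hΨ : IsFundamentalMatrix L T Ψ) (hL : ∀ t ∈ Icc 0 T, (L t).IsSymm) :
    ∀ t ∈ Icc 0 T, (Ψ t).det = 1 := by
  have hd : ∀ t ∈ Icc 0 T, HasDerivWithinAt (fun s => (Ψ s).det) 0 (Icc 0 T) t := by
    intro t ht
    have h := ((hΨ.2 t ht 0 0).mul (hΨ.2 t ht 1 1)).sub ((hΨ.2 t ht 0 1).mul (hΨ.2 t ht 1 0))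
    have hsymm : L t 1 0 = L t 0 1 := (hL t ht).apply 0 1
    simp only [Matrix.det_fin_two]
    refine h.congr_deriv ?_
    simp only [matJ, Matrix.mul_apply, Fin.sum_univ_two]
    simp [hsymm]
    ring
  intro t ht
  have h0 : (0 : ℝ) ∈ Icc 0 T := ⟨le_rfl, ht.1.trans ht.2⟩
  have := (convex_Icc 0 T).norm_image_sub_le_of_norm_hasDerivWithin_le (C := 0)
    (fun s hs => hd s hs) (fun s _ => by simp) h0 ht
  rw [zero_mul, norm_le_zero_iff, sub_eq_zero, hΨ.1, Matrix.det_one] at this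
  exact this

/-! ### Polar lifts and the angle of rotation -/

/-- A continuous angle whose cosine stays positive never leaves its half-circle. -/
theorem abs_sub_lt_of_cos_pos {f : ℝ → ℝ} {a b : ℝ} (hf : ContinuousOn f (Icc a b))
    (hcos : ∀ t ∈ Icc a b, 0 < cos (f t)) {k : ℤ} {s t : ℝ} (hs : s ∈ Icc a b)
    (ht : t ∈ Icc a b) (h : |f s - k * (2 * π)| < π / 2) : |f t - k * (2 * π)| < π / 2 := by
  have hoc : OrdConnected (f '' Icc a b) := (isPreconnected_Icc.image f hf).ordConnected
  have hne : ∀ x ∈ f '' Icc a b, cos x ≠ 0 := by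
    rintro _ ⟨u, hu, rfl⟩
    exact (hcos u hu).ne'
  rw [abs_lt] at h ⊢
  constructor
  · by_contra! hlt
    refine hne (-(π / 2) + k * (2 * π)) (hoc.out (mem_image_of_mem f ht) (mem_image_of_mem f hs)
      ⟨by linarith, by linarith⟩) ?_
    rw [cos_add_int_mul_two_pi, cos_neg, cos_pi_div_two]
  · by_contra! hlt
    refine hne (π / 2 + k * (2 * π)) (hoc.out (mem_image_of_mem f hs) (mem_image_of_mem f ht)
      ⟨by linarith, by linarith⟩) ?_
    rw [cos_add_int_mul_two_pi, cos_pi_div_two]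

/-- Whether the Maslov index is `2M` is visible at time `T`: if `det (I - E) < 0`, then along the
nonresonant extension the angle of the rotation stays in one half-circle. -/
theorem IsMaslovIndex.exists_angle {Ψ : ℝ → Mat2} {T : ℝ} (hT : 0 < T)
    (hnonres : (1 - Ψ T).det ≠ 0) {i : ℤ} (hi : IsMaslovIndex Ψ T i) :
    ∃ θ : ℝ → ℝ, ContinuousOn θ (Icc 0 T) ∧ θ 0 = 0 ∧
      (∀ t ∈ Icc 0 T, ∃ τ σ : ℝ, 0 ≤ τ ∧ Ψ t = hypMat τ σ * rotMat (θ t)) ∧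
      ∀ M : ℤ, i = 2 * M ↔ (1 - Ψ T).det < 0 ∧ |θ T + 2 * M * π| < π / 2 := by
  obtain ⟨E, θ, hE, hEΨ, hres, hend, -, hθ, hθ0, hdec, hθT⟩ := hi
  have hsub : Icc 0 T ⊆ Icc 0 (T + 1) := Icc_subset_Icc le_rfl (by linarith)
  have hsub' : Icc T (T + 1) ⊆ Icc 0 (T + 1) := Icc_subset_Icc hT.le le_rfl
  have hTl : T ∈ Icc T (T + 1) := ⟨le_rfl, by linarith⟩
  have hTr : T + 1 ∈ Icc T (T + 1) := ⟨by linarith, le_rfl⟩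
  have hET : E T = Ψ T := hEΨ T ⟨hT.le, le_rfl⟩
  refine ⟨θ, hθ.mono hsub, hθ0, fun t ht => by rw [← hEΨ t ht]; exact hdec t (hsub ht), fun M => ?_⟩
  have hcos : (1 - Ψ T).det < 0 → ∀ t ∈ Icc T (T + 1), 0 < cos (θ t) := by
    intro hneg t ht
    by_contra! hle
    obtain ⟨τ, σ, -, hEt⟩ := hdec t (hsub' ht)
    have hpos : 0 < (1 - E t).det := by
      rw [hEt, det_one_sub_hypMat_mul_rotMat]
      nlinarith [cosh_pos τ]
    have hdc : ContinuousOn (fun t => (1 - E t).det) (Icc T (T + 1)) := by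
      have : Continuous fun B : Mat2 => (1 - B).det :=
        (continuous_const.sub continuous_id).matrix_det
      exact this.comp_continuousOn (hE.mono hsub')
    have hoc := (isPreconnected_Icc.image _ hdc).ordConnected
    obtain ⟨s, hs, hs0⟩ := hoc.out (mem_image_of_mem _ hTl) (mem_image_of_mem _ ht)
      (⟨by simpa only [hET] using hneg.le, hpos.le⟩ : (0 : ℝ) ∈ Icc _ _)
    exact hres s hs hs0
  have hM : ∀ t, θ t + 2 * M * π = θ t - ((-M : ℤ) : ℝ) * (2 * π) := fun t => by
    push_cast; ring
  constructor
  · rintro rfl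
    have hneg : (1 - Ψ T).det < 0 := by
      refine hnonres.lt_or_gt.resolve_right fun hpos => ?_
      obtain ⟨τ, σ, -, hEt⟩ := hdec (T + 1) (hsub' hTr)
      have h1 := det_one_sub_hypMat_mul_rotMat τ σ (θ (T + 1))
      have h2 : cos (θ (T + 1)) = 1 := by
        rw [hθT, cos_neg, ← cos_int_mul_two_pi M]
        congr 1; push_cast; ring
      have h3 : (0 : ℝ) < (1 - (-1 : Mat2)).det := by
        rw [Matrix.det_fin_two]; simp
      rw [← hEt, hend hpos, h2] at h1
      linarith [one_le_cosh τ]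
    refine ⟨hneg, ?_⟩
    rw [hM]
    refine abs_sub_lt_of_cos_pos (hθ.mono hsub') (hcos hneg) hTr hTl ?_
    rw [← hM, hθT]
    push_cast
    rw [neg_add_cancel, abs_zero]
    exact pi_div_two_pos
  · rintro ⟨hneg, hlt⟩
    rw [hM] at hlt
    have h1 := abs_sub_lt_of_cos_pos (hθ.mono hsub') (hcos hneg) hTl hTr hlt
    rw [← hM, hθT, show -((i : ℝ) * π) + 2 * M * π = ((2 * M - i : ℤ) : ℝ) * π by push_cast; ring,
      abs_mul, abs_of_pos pi_pos] at h1
    have h2 : |((2 * M - i : ℤ) : ℝ)| < 1 := by nlinarith [pi_pos]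
    have h3 : |2 * M - i| < 1 := by exact_mod_cast h2
    have h4 := Int.abs_lt_one_iff.1 h3
    linarith

namespace IsPolarLift

variable {Ψ : ℝ → Mat2} {T : ℝ} {P : ℝ → ℝ → ℝ → ℝ × ℝ}

theorem mul_cos (hP : IsPolarLift Ψ T P) {t : ℝ} (ht : t ∈ Icc 0 T) (φ : ℝ) {r : ℝ} (hr : 0 < r) :
    (P t φ r).2 * cos (P t φ r).1 = r * (Ψ t 0 0 * cos φ - Ψ t 0 1 * sin φ) := by
  have h := congrFun (congrArg WithLp.ofLp (hP.lift t ht φ r hr)) 0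
  simp [polarProj, Matrix.mulVec, dotProduct, Fin.sum_univ_two] at h
  linear_combination h

theorem mul_sin (hP : IsPolarLift Ψ T P) {t : ℝ} (ht : t ∈ Icc 0 T) (φ : ℝ) {r : ℝ} (hr : 0 < r) :
    (P t φ r).2 * sin (P t φ r).1 = -(r * (Ψ t 1 0 * cos φ - Ψ t 1 1 * sin φ)) := by
  have h := congrFun (congrArg WithLp.ofLp (hP.lift t ht φ r hr)) 1
  simp [polarProj, Matrix.mulVec, dotProduct, Fin.sum_univ_two] at h
  linear_combination -h

theorem continuousOn_time (hP : IsPolarLift Ψ T P) (φ : ℝ) {r : ℝ} (hr : 0 < r) :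
    ContinuousOn (fun t => P t φ r) (Icc 0 T) :=
  hP.cont.comp (f := fun t : ℝ => (t, φ, r)) (by fun_prop) fun _ ht => ⟨ht, trivial, hr⟩

theorem continuousOn_space (hP : IsPolarLift Ψ T P) (hT : 0 < T) :
    ContinuousOn (fun p : ℝ × ℝ => P T p.1 p.2) (univ ×ˢ Ioi 0) :=
  hP.cont.comp (f := fun p : ℝ × ℝ => (T, p.1, p.2)) (by fun_prop)
    fun _ hp => ⟨⟨hT.le, le_rfl⟩, hp⟩

/-- The angle of the rotation factor of `Ψ(t)`, recovered from the polar lift of one orbit. -/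
theorem exists_isMaslovIndex (hP : IsPolarLift Ψ T P) (hT : 0 < T)
    (hc : ContinuousOn Ψ (Icc 0 T)) (hdet : ∀ t ∈ Icc 0 T, (Ψ t).det = 1) (h0 : Ψ 0 = 1)
    (hnonres : (1 - Ψ T).det ≠ 0) : ∃ i, IsMaslovIndex Ψ T i := by
  set α : ℝ → ℝ := fun t => (P t 0 1).1 with hα
  have hαc : ContinuousOn α (Icc 0 T) :=
    continuous_fst.comp_continuousOn (hP.continuousOn_time 0 one_pos)
  have hent : ∀ i j : Fin 2, ContinuousOn (fun t => Ψ t i j) (Icc 0 T) := fun i j =>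
    continuousOn_pi.1 (continuousOn_pi.1 hc i) j
  set U : ℝ → ℝ := fun t =>
    (Ψ t 0 0 + Ψ t 1 1) * cos (α t) + (Ψ t 0 1 - Ψ t 1 0) * sin (α t) with hU
  set V : ℝ → ℝ := fun t =>
    (Ψ t 0 1 - Ψ t 1 0) * cos (α t) - (Ψ t 0 0 + Ψ t 1 1) * sin (α t) with hV
  have hUpos : ∀ t ∈ Icc 0 T, 0 < U t := by
    intro t ht
    have hρ := hP.radius_pos t ht 0 1 one_pos
    have h1 := hP.mul_cos ht 0 one_pos
    have h2 := hP.mul_sin ht 0 one_pos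
    have h3 := hdet t ht
    rw [Matrix.det_fin_two] at h3
    simp only [cos_zero, sin_zero, mul_one, mul_zero, sub_zero, one_mul] at h1 h2
    refine pos_of_mul_pos_right (a := (P t 0 1).2) ?_ hρ.le
    have : (P t 0 1).2 * U t = Ψ t 0 0 ^ 2 + Ψ t 1 0 ^ 2 + 1 := by
      simp only [hU, hα]
      linear_combination (Ψ t 0 0 + Ψ t 1 1) * h1 + (Ψ t 0 1 - Ψ t 1 0) * h2 + h3
    rw [this]; positivity
  set z : ℝ → ℂ := fun t => U t + V t * Complex.I with hz
  have hre : ∀ t, (z t).re = U t := fun t => by simp [hz]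
  have him : ∀ t, (z t).im = V t := fun t => by simp [hz]
  have hzc : ContinuousOn z (Icc 0 T) := by
    have := hent 0 0
    have := hent 0 1
    have := hent 1 0
    have := hent 1 1
    have hUc : ContinuousOn U (Icc 0 T) := by fun_prop
    have hVc : ContinuousOn V (Icc 0 T) := by fun_prop
    fun_prop
  have hargc : ContinuousOn (fun t => (z t).arg) (Icc 0 T) := fun t ht =>
    (Complex.continuousAt_arg (Or.inl (by rw [hre]; exact hUpos t ht))).comp_continuousWithinAt
      (hzc t ht)
  refine exists_isMaslovIndex_of_angle hT hc (θ := fun t => α t + (z t).arg) (hαc.add hargc) ?_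
    (fun t ht => ?_) hnonres
  · have hα0 : α 0 = 0 := by simp [hα, hP.start 0 1 one_pos]
    have : z 0 = ((2 : ℝ) : ℂ) := by
      simp [hz, hU, hV, hα0, h0]; norm_num
    simp only [hα0, this, Complex.arg_ofReal_of_nonneg zero_le_two, add_zero]
  · have hzp : 0 < ‖z t‖ := norm_pos_iff.2 fun h => by
      have := hUpos t ht
      rw [← hre, h] at this
      simp at this
    have h1 : ‖z t‖ * cos (z t).arg = U t := by rw [Complex.norm_mul_cos_arg, hre]
    have h2 : ‖z t‖ * sin (z t).arg = V t := by rw [Complex.norm_mul_sin_arg, him]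
    have hcs := cos_sq_add_sin_sq (z t).arg
    refine exists_eq_hypMat_mul_rotMat (hdet t ht) ?_ ?_
    · have : U t * sin (z t).arg - V t * cos (z t).arg = 0 := by rw [← h1, ← h2]; ring
      simp only [hU, hV] at this
      rw [sin_add, cos_add]
      linear_combination this
    · have : U t * cos (z t).arg + V t * sin (z t).arg = ‖z t‖ := by
        rw [← h1, ← h2]; linear_combination ‖z t‖ * hcs
      rw [← this] at hzp
      simp only [hU, hV] at hzp
      rw [sin_add, cos_add]
      linarith

/-- The positive definite factor turns every vector by less than a right angle, so the polar lift
of every orbit turns by the angle of the rotation factor up to `π / 2`. -/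
theorem abs_angle_sub_lt (hP : IsPolarLift Ψ T P) {θ : ℝ → ℝ} (hθ : ContinuousOn θ (Icc 0 T))
    (hθ0 : θ 0 = 0) (hdec : ∀ t ∈ Icc 0 T, ∃ τ σ : ℝ, 0 ≤ τ ∧ Ψ t = hypMat τ σ * rotMat (θ t))
    {t : ℝ} (ht : t ∈ Icc 0 T) (φ : ℝ) {r : ℝ} (hr : 0 < r) :
    |(P t φ r).1 - φ - θ t| < π / 2 := by
  have hc : ContinuousOn (fun t => (P t φ r).1 - φ - θ t) (Icc 0 T) :=
    ((continuous_fst.comp_continuousOn (hP.continuousOn_time φ hr)).sub continuousOn_const).sub hθ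
  have h0 : (0 : ℝ) ∈ Icc 0 T := ⟨le_rfl, ht.1.trans ht.2⟩
  have := abs_sub_lt_of_cos_pos (k := 0) hc (fun s hs => ?_) h0 ht
    (by simp [hP.start φ r hr, hθ0, pi_pos])
  · simpa using this
  obtain ⟨τ, σ, hτ, hs'⟩ := hdec s hs
  have hρ := hP.radius_pos s hs φ r hr
  have h1 := hP.mul_cos hs φ hr
  have h2 := hP.mul_sin hs φ hr
  obtain ⟨ψ, hψ⟩ : ∃ ψ, ψ = φ + θ s := ⟨_, rfl⟩
  have h3 : (P s φ r).2 * cos ((P s φ r).1 - φ - θ s) =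
      r * (cosh τ + sinh τ * cos (σ + 2 * ψ)) := by
    rw [sub_sub, ← hψ, cos_sub, cos_add, cos_two_mul, sin_two_mul]
    simp only [hs', hypMat, rotMat, Matrix.mul_apply, Fin.sum_univ_two, Matrix.of_apply,
      Matrix.cons_val', Matrix.cons_val_zero, Matrix.cons_val_one, Matrix.cons_val_fin_one] at h1 h2
    have hcs := cos_sq_add_sin_sq ψ
    have hcψ : cos ψ = cos φ * cos (θ s) - sin φ * sin (θ s) := by rw [hψ, cos_add]
    have hsψ : sin ψ = sin φ * cos (θ s) + cos φ * sin (θ s) := by rw [hψ, sin_add]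
    have h1' : (P s φ r).2 * cos (P s φ r).1 = r * ((cosh τ + sinh τ * cos σ) * cos ψ -
        sinh τ * sin σ * sin ψ) := by
      rw [h1, hcψ, hsψ]; ring
    have h2' : (P s φ r).2 * sin (P s φ r).1 = -(r * (sinh τ * sin σ * cos ψ -
        (cosh τ - sinh τ * cos σ) * sin ψ)) := by
      rw [h2, hcψ, hsψ]; ring
    linear_combination cos ψ * h1' + sin ψ * h2' +
      r * (cosh τ - sinh τ * cos σ) * hcs
  have h4 : 0 < r * (cosh τ + sinh τ * cos (σ + 2 * ψ)) := by
    refine mul_pos hr ?_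
    have h5 := sinh_nonneg_iff.2 hτ
    have h6 := neg_one_le_cos (σ + 2 * ψ)
    have h7 := sinh_lt_cosh τ
    nlinarith
  rw [← h3] at h4
  exact pos_of_mul_pos_right h4 hρ.le

/-- The time `T` map commutes with the deck transformation `φ ↦ φ + 2π`. -/
theorem apply_add_two_pi (hP : IsPolarLift Ψ T P) (hT : 0 < T) {θ : ℝ → ℝ}
    (hθ : ContinuousOn θ (Icc 0 T)) (hθ0 : θ 0 = 0)
    (hdec : ∀ t ∈ Icc 0 T, ∃ τ σ : ℝ, 0 ≤ τ ∧ Ψ t = hypMat τ σ * rotMat (θ t))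
    (φ : ℝ) {r : ℝ} (hr : 0 < r) :
    P T (φ + 2 * π) r = ((P T φ r).1 + 2 * π, (P T φ r).2) := by
  have hTm : T ∈ Icc 0 T := ⟨hT.le, le_rfl⟩
  have h1 := hP.mul_cos hTm (φ + 2 * π) hr
  have h2 := hP.mul_sin hTm (φ + 2 * π) hr
  rw [cos_add_two_pi, sin_add_two_pi] at h1 h2
  rw [← hP.mul_cos hTm φ hr] at h1
  rw [← hP.mul_sin hTm φ hr] at h2
  have hρ := hP.radius_pos T hTm φ r hr
  have hρ' := hP.radius_pos T hTm (φ + 2 * π) r hr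
  have hrad : (P T (φ + 2 * π) r).2 = (P T φ r).2 := by
    refine (pow_left_inj₀ hρ'.le hρ.le two_ne_zero).1 ?_
    have c1 := cos_sq_add_sin_sq (P T (φ + 2 * π) r).1
    have c2 := cos_sq_add_sin_sq (P T φ r).1
    linear_combination (-(P T (φ + 2 * π) r).2 ^ 2) * c1 + (P T φ r).2 ^ 2 * c2 +
      ((P T (φ + 2 * π) r).2 * cos (P T (φ + 2 * π) r).1 + (P T φ r).2 * cos (P T φ r).1) * h1 +
      ((P T (φ + 2 * π) r).2 * sin (P T (φ + 2 * π) r).1 + (P T φ r).2 * sin (P T φ r).1) * h2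
  rw [hrad, mul_right_inj' hρ.ne'] at h1 h2
  obtain ⟨k, hk⟩ := Real.Angle.angle_eq_iff_two_pi_dvd_sub.1 (Real.Angle.cos_sin_inj h1 h2)
  have h3 := abs_lt.1 (hP.abs_angle_sub_lt hθ hθ0 hdec hTm φ hr)
  have h4 := abs_lt.1 (hP.abs_angle_sub_lt hθ hθ0 hdec hTm (φ + 2 * π) hr)
  have h5 : k = 1 := by
    have h6 : |((k - 1 : ℤ) : ℝ)| < 1 := by
      rw [abs_lt]
      push_cast
      constructor <;> nlinarith [pi_pos]
    have h7 : |k - 1| < 1 := by exact_mod_cast h6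
    linarith [Int.abs_lt_one_iff.1 h7]
  rw [h5, Int.cast_one] at hk
  ext
  · simp only; linarith
  · exact hrad

/-- In the complex coordinate `w = x - i y`, in which `Π(φ, r)` is `r e^{iφ}`, the quotient
`(Ψ(t) w) / w` on the ray of angle `φ` is a constant plus a term that turns twice. -/
theorem complex_displacement (hP : IsPolarLift Ψ T P) {t : ℝ} (ht : t ∈ Icc 0 T) (φ : ℝ) {r : ℝ}
    (hr : 0 < r) :
    ((P t φ r).2 / r : ℂ) * Complex.exp (((P t φ r).1 - φ : ℝ) * Complex.I) =
      ((Ψ t 0 0 + Ψ t 1 1) + (Ψ t 0 1 - Ψ t 1 0) * Complex.I) / 2 +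
      ((Ψ t 0 0 - Ψ t 1 1) - (Ψ t 0 1 + Ψ t 1 0) * Complex.I) / 2 *
        Complex.exp ((-2 : ℤ) * φ * Complex.I) := by
  have h1 : ((P t φ r).2 : ℂ) * Complex.exp ((P t φ r).1 * Complex.I) =
      r * (((Ψ t 0 0 + Ψ t 1 1) + (Ψ t 0 1 - Ψ t 1 0) * Complex.I) / 2 *
          Complex.exp (φ * Complex.I) +
        ((Ψ t 0 0 - Ψ t 1 1) - (Ψ t 0 1 + Ψ t 1 0) * Complex.I) / 2 *
          Complex.exp (-(φ * Complex.I))) := by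
    have hc : (((P t φ r).2 * cos (P t φ r).1 : ℝ) : ℂ) = _ :=
      congrArg _ (hP.mul_cos ht φ hr)
    have hs : (((P t φ r).2 * sin (P t φ r).1 : ℝ) : ℂ) = _ :=
      congrArg _ (hP.mul_sin ht φ hr)
    rw [← neg_mul, Complex.exp_mul_I, Complex.exp_mul_I, Complex.exp_mul_I, Complex.cos_neg,
      Complex.sin_neg]
    push_cast at hc hs
    linear_combination hc + Complex.I * hs +
      (-r * (Ψ t 0 1 * Complex.sin φ)) * Complex.I_sq
  have hr' : (r : ℂ) ≠ 0 := by exact_mod_cast hr.ne'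
  have h2 : Complex.exp (((P t φ r).1 - φ : ℝ) * Complex.I) =
      Complex.exp ((P t φ r).1 * Complex.I) * Complex.exp (-(φ * Complex.I)) := by
    rw [← Complex.exp_add]; congr 1; push_cast; ring
  have h3 : Complex.exp ((-2 : ℤ) * φ * Complex.I) =
      Complex.exp (-(φ * Complex.I)) * Complex.exp (-(φ * Complex.I)) := by
    rw [← Complex.exp_add]; congr 1; push_cast; ring
  have h4 : Complex.exp (φ * Complex.I) * Complex.exp (-(φ * Complex.I)) = 1 := by
    rw [← Complex.exp_add, add_neg_cancel, Complex.exp_zero]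
  rw [h2, h3, div_mul_eq_mul_div, div_eq_iff hr', ← mul_assoc, h1]
  linear_combination r * (((Ψ t 0 0 + Ψ t 1 1) + (Ψ t 0 1 - Ψ t 1 0) * Complex.I) / 2) * h4

end IsPolarLift

/-! ### Winding of the displacement -/

theorem mul_sin_nonneg {x : ℝ} (h : |x| ≤ π) : 0 ≤ x * sin x := by
  obtain ⟨h1, h2⟩ := abs_le.1 h
  rcases le_total 0 x with hx | hx
  · exact mul_nonneg hx (sin_nonneg_of_nonneg_of_le_pi hx h2)
  · exact mul_nonneg_of_nonpos_of_nonpos hx (sin_nonpos_of_nonpos_of_neg_pi_le hx h1)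

/-- For `|δ| ≤ π` the vectors `(ρ - r) + iδ` and `(ρ / r) e^{iδ} - 1` are never opposite: their
imaginary parts have the same sign, and so have their real parts when `δ = 0`. -/
theorem div_mem_slitPlane_of_abs_le_pi {ρ r δ : ℝ} (hρ : 0 < ρ) (hr : 0 < r) (hδ : |δ| ≤ π)
    (h0 : (ρ / r : ℂ) * Complex.exp (δ * Complex.I) - 1 ≠ 0) :
    ((ρ - r : ℝ) + δ * Complex.I : ℂ) / ((ρ / r : ℂ) * Complex.exp (δ * Complex.I) - 1) ∈
      Complex.slitPlane := by
  rw [Complex.mem_slitPlane_iff_not_le_zero]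
  intro hle
  obtain ⟨s, hs, hs'⟩ : ∃ s : ℝ, 0 ≤ s ∧
      ((ρ - r : ℝ) + δ * Complex.I : ℂ) / ((ρ / r : ℂ) * Complex.exp (δ * Complex.I) - 1) =
        ((-s : ℝ) : ℂ) := by
    obtain ⟨h1, h2⟩ := Complex.le_def.1 hle
    refine ⟨-(((ρ - r : ℝ) + δ * Complex.I : ℂ) /
      ((ρ / r : ℂ) * Complex.exp (δ * Complex.I) - 1)).re, by simpa using h1, ?_⟩
    rw [neg_neg]
    exact Complex.ext (by simp) (by simpa using h2)
  rw [div_eq_iff h0, Complex.exp_mul_I, ← Complex.ofReal_cos, ← Complex.ofReal_sin,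
    ← Complex.ofReal_div] at hs'
  have hre := congrArg Complex.re hs'
  have him := congrArg Complex.im hs'
  simp [-Complex.ofReal_cos, -Complex.ofReal_sin] at hre him
  have hδ0 : δ = 0 := by
    have h1 := mul_sin_nonneg hδ
    have h2 : δ * δ = -(s * (ρ / r)) * (δ * sin δ) := by nth_rw 2 [him]; ring
    have h3 : 0 ≤ s * (ρ / r) := by positivity
    nlinarith
  rw [hδ0, cos_zero, mul_one] at hre
  have h4 : (ρ - r) * (1 + s / r) = 0 := by
    field_simp at hre ⊢
    linear_combination hre
  have h5 : ρ = r := by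
    rcases mul_eq_zero.1 h4 with h | h
    · linarith
    · exact absurd h (by positivity)
  apply h0
  rw [h5, hδ0, div_self (by exact_mod_cast hr.ne')]
  simp

theorem planeToComplex_displacement_add (P : ℝ → ℝ → ℝ → ℝ × ℝ) (T φ r b : ℝ) :
    planeToComplex (displacement P T φ r + !₂[b, 0]) =
      ((P T φ r).1 - φ + b : ℝ) + ((P T φ r).2 - r : ℝ) * Complex.I := by
  simp [planeToComplex, displacement]

/-- If the shifted angular displacement has no zero, the displacement stays in a half-plane. -/
theorem hasWinding_zero_of_ne_zero {c : ℝ → ℂ} (hc : Continuous c)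
    (hper : ∀ φ, c (φ + 2 * π) = c φ) (hne : ∀ φ, (c φ).re ≠ 0) : HasWinding c 0 := by
  have hre : Continuous fun φ => (c φ).re := Complex.continuous_re.comp hc
  have hsign : (∀ φ, 0 < (c φ).re) ∨ ∀ φ, (c φ).re < 0 := by
    by_contra! h
    obtain ⟨⟨x, hx⟩, y, hy⟩ := h
    obtain ⟨φ, hφ⟩ := mem_range_of_exists_le_of_exists_ge hre ⟨x, hx⟩ ⟨y, hy⟩
    exact hne φ hφ
  rcases hsign with h | h
  · exact HasWinding.one.of_div_mem_slitPlane hc hper fun φ => by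
      rw [div_one]; exact Or.inl (h φ)
  · exact (HasWinding.one.const_mul (a := -1) (by simp)).of_div_mem_slitPlane hc hper fun φ => by
      rw [mul_one, div_neg, div_one]
      exact Or.inl (by simpa using h φ)

/-- If `det (I - A) < 0`, then `(A w - w) / w` is dominated by its part that turns twice. -/
theorem norm_sub_one_lt_of_det_lt_zero {A : Mat2} (hneg : (1 - A).det < 0) :
    ‖((A 0 0 + A 1 1) + (A 0 1 - A 1 0) * Complex.I : ℂ) / 2 - 1‖ <
      ‖((A 0 0 - A 1 1) - (A 0 1 + A 1 0) * Complex.I : ℂ) / 2‖ := by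
  have h1 : ((A 0 0 + A 1 1) + (A 0 1 - A 1 0) * Complex.I : ℂ) / 2 - 1 =
      (((A 0 0 + A 1 1) / 2 - 1 : ℝ) : ℂ) + (((A 0 1 - A 1 0) / 2 : ℝ) : ℂ) * Complex.I := by
    push_cast; ring
  have h2 : ((A 0 0 - A 1 1) - (A 0 1 + A 1 0) * Complex.I : ℂ) / 2 =
      (((A 0 0 - A 1 1) / 2 : ℝ) : ℂ) + ((-(A 0 1 + A 1 0) / 2 : ℝ) : ℂ) * Complex.I := by
    push_cast; ring
  rw [h1, h2, Complex.norm_add_mul_I, Complex.norm_add_mul_I]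
  refine sqrt_lt_sqrt (by positivity) ?_
  rw [Matrix.det_fin_two] at hneg
  simp at hneg
  nlinarith

namespace IsPolarLift

variable {Ψ : ℝ → Mat2} {T : ℝ} {P : ℝ → ℝ → ℝ → ℝ × ℝ}

/-- Where the angular displacement is a multiple of `2π`, the matrix has a positive eigenvalue. -/
theorem det_one_sub_nonpos (hP : IsPolarLift Ψ T P) {t : ℝ} (ht : t ∈ Icc 0 T)
    (hdet : (Ψ t).det = 1) {φ r : ℝ} (hr : 0 < r) {k : ℤ}
    (hφ : (P t φ r).1 = φ + k * (2 * π)) : (1 - Ψ t).det ≤ 0 := by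
  have h1 := hP.mul_cos ht φ hr
  have h2 := hP.mul_sin ht φ hr
  have h3 := cos_sq_add_sin_sq φ
  have hρ := hP.radius_pos t ht φ r hr
  rw [hφ, cos_add_int_mul_two_pi] at h1
  rw [hφ, sin_add_int_mul_two_pi] at h2
  set ρ := (P t φ r).2 with hρ'
  rw [Matrix.det_fin_two] at hdet ⊢
  simp
  -- `ρ / r` is a root of the characteristic polynomial
  have hchar : (Ψ t 0 0 - ρ / r) * (Ψ t 1 1 - ρ / r) - Ψ t 0 1 * Ψ t 1 0 = 0 := by
    have h1' : (Ψ t 0 0 - ρ / r) * cos φ - Ψ t 0 1 * sin φ = 0 := by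
      field_simp; linear_combination -h1
    have h2' : Ψ t 1 0 * cos φ - (Ψ t 1 1 - ρ / r) * sin φ = 0 := by
      field_simp; linear_combination h2
    linear_combination (-((Ψ t 0 0 - ρ / r) * (Ψ t 1 1 - ρ / r) - Ψ t 0 1 * Ψ t 1 0)) * h3 +
      (cos φ * (Ψ t 1 1 - ρ / r) + sin φ * Ψ t 1 0) * h1' -
      (cos φ * Ψ t 0 1 + sin φ * (Ψ t 0 0 - ρ / r)) * h2'
  have hl : 0 < ρ / r := by positivity
  by_contra! hpos
  nlinarith [mul_pos (sub_pos.2 hpos) hl, sq_nonneg (ρ / r - 1)]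

/-- The degree of the displacement, shifted by `2πM` in the angle, in terms of any Maslov datum. -/
theorem hasFixedRadiusDegree_displacement (hP : IsPolarLift Ψ T P) (hT : 0 < T)
    (hdet : (Ψ T).det = 1) (hnonres : (1 - Ψ T).det ≠ 0) {i : ℤ} (hi : IsMaslovIndex Ψ T i)
    (M : ℤ) {r : ℝ} (hr : 0 < r) :
    HasFixedRadiusDegree (fun φ ρ => displacement P T φ ρ + !₂[2 * (M : ℝ) * π, 0]) r
      (if i = 2 * M then -2 else 0) := by
  obtain ⟨θ, hθ, hθ0, hdec, hM⟩ := hi.exists_angle hT hnonres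
  have hTm : T ∈ Icc 0 T := ⟨hT.le, le_rfl⟩
  have hangle := fun φ => hP.abs_angle_sub_lt hθ hθ0 hdec hTm φ hr
  have hPs := hP.continuousOn_space hT
  have hcont : ContinuousOn (fun p : ℝ × ℝ =>
      displacement P T p.1 p.2 + !₂[2 * (M : ℝ) * π, 0]) (univ ×ˢ Ioi 0) := by
    refine ContinuousOn.add ?_ continuousOn_const
    refine (PiLp.continuous_toLp 2 _).comp_continuousOn (continuousOn_pi.2 fun j => ?_)
    fin_cases j
    · exact (continuous_fst.comp_continuousOn hPs).sub continuousOn_fst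
    · exact (continuous_snd.comp_continuousOn hPs).sub continuousOn_snd
  have hPc : Continuous fun φ => P T φ r :=
    hPs.comp_continuous (f := fun φ : ℝ => (φ, r)) (by fun_prop) fun φ => ⟨trivial, hr⟩
  have hPper := fun φ => hP.apply_add_two_pi hT hθ hθ0 hdec φ hr
  set δ : ℝ → ℝ := fun φ => (P T φ r).1 - φ + 2 * M * π with hδ
  have hδper : ∀ φ, δ (φ + 2 * π) = δ φ := fun φ => by simp only [hδ, hPper]; ring
  have hδc : Continuous δ := by fun_prop
  have hcomplex : (fun φ => planeToComplex (displacement P T φ r + !₂[2 * (M : ℝ) * π, 0])) =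
      fun φ => (δ φ + ((P T φ r).2 - r : ℝ) * Complex.I : ℂ) := by
    ext φ; exact planeToComplex_displacement_add P T φ r _
  split_ifs with hiM
  · obtain ⟨hneg, hθT⟩ := (hM M).1 hiM
    set p : ℂ := ((Ψ T 0 0 + Ψ T 1 1) + (Ψ T 0 1 - Ψ T 1 0) * Complex.I) / 2 with hp
    set q : ℂ := ((Ψ T 0 0 - Ψ T 1 1) - (Ψ T 0 1 + Ψ T 1 0) * Complex.I) / 2 with hq
    have hpq : ‖p - 1‖ < ‖q‖ := norm_sub_one_lt_of_det_lt_zero hneg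
    have hq0 : q ≠ 0 := norm_pos_iff.1 ((norm_nonneg _).trans_lt hpq)
    have hδle : ∀ φ, |δ φ| ≤ π := fun φ => by
      have h1 := abs_lt.1 (hangle φ)
      have h2 := abs_lt.1 hθT
      exact abs_le.2 ⟨by simp only [hδ]; linarith, by simp only [hδ]; linarith⟩
    have hζ : ∀ φ, ((P T φ r).2 / r : ℂ) * Complex.exp (δ φ * Complex.I) - 1 =
        (p - 1) + q * Complex.exp ((-2 : ℤ) * φ * Complex.I) := fun φ => by
      have h1 := hP.complex_displacement hTm φ hr
      have h2 : Complex.exp (δ φ * Complex.I) =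
          Complex.exp (((P T φ r).1 - φ : ℝ) * Complex.I) := by
        rw [← mul_one (Complex.exp (((P T φ r).1 - φ : ℝ) * Complex.I)),
          ← Complex.exp_int_mul_two_pi_mul_I M, ← Complex.exp_add]
        congr 1
        simp only [hδ]; push_cast; ring
      rw [h2, h1]; ring
    have hw0 : HasWinding (fun φ => q * Complex.exp ((-2 : ℤ) * φ * Complex.I)) (-2) :=
      (HasWinding.exp_int_mul (-2)).const_mul hq0
    have hw1 : HasWinding (fun φ => (p - 1) + q * Complex.exp ((-2 : ℤ) * φ * Complex.I)) (-2) := by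
      refine hw0.of_div_mem_slitPlane (continuous_const.add hw0.continuous)
        (fun φ => congrArg _ (hw0.periodic φ)) fun φ => ?_
      have h0 := hw0.ne_zero φ
      rw [add_div, div_self h0, add_comm]
      refine Complex.mem_slitPlane_of_norm_lt_one ?_
      have hn : ‖Complex.exp ((-2 : ℤ) * φ * Complex.I)‖ = 1 := by
        rw [show (((-2 : ℤ) : ℂ) * φ * Complex.I) = ((-2 * φ : ℝ) : ℂ) * Complex.I by push_cast; ring]
        exact Complex.norm_exp_ofReal_mul_I _
      rw [norm_div, norm_mul, hn, mul_one, div_lt_one (norm_pos_iff.2 hq0)]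
      exact hpq
    have hw2 : HasWinding (fun φ => (((P T φ r).2 - r : ℝ) + δ φ * Complex.I : ℂ)) (-2) := by
      refine hw1.of_div_mem_slitPlane (by fun_prop) (fun φ => by simp only [hPper, hδper])
        fun φ => ?_
      have h0 := hw1.ne_zero φ
      simp only [← hζ] at h0 ⊢
      exact div_mem_slitPlane_of_abs_le_pi (hP.radius_pos T hTm φ r hr) hr (hδle φ) h0
    have hw3 : HasWinding (fun φ => planeToComplex
        (displacement P T φ r + !₂[2 * (M : ℝ) * π, 0])) 2 := by
      rw [hcomplex, show (2 : ℤ) = - -2 from rfl]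
      convert hw2.conj.const_mul Complex.I_ne_zero using 2 with φ
      simp only [map_add, map_mul, Complex.conj_I, Complex.conj_ofReal]
      linear_combination (δ φ : ℂ) * Complex.I_sq
    exact hasFixedRadiusDegree_of_hasWinding hcont hr hw3
  · have hδne : ∀ φ, δ φ ≠ 0 := by
      intro φ h0
      have h1 : (P T φ r).1 = φ + ((-M : ℤ) : ℝ) * (2 * π) := by
        simp only [hδ] at h0; push_cast; linarith
      refine hiM ((hM M).2 ⟨(hP.det_one_sub_nonpos hTm hdet hr h1).lt_of_ne hnonres, ?_⟩)
      have h2 := hangle φ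
      rwa [h1, ← abs_neg, show -(φ + ((-M : ℤ) : ℝ) * (2 * π) - φ - θ T) = θ T + 2 * M * π by
        push_cast; ring] at h2
    have hw : HasWinding (fun φ => planeToComplex
        (displacement P T φ r + !₂[2 * (M : ℝ) * π, 0])) 0 := by
      rw [hcomplex]
      exact hasWinding_zero_of_ne_zero (by fun_prop) (fun φ => by simp only [hPper, hδper])
        fun φ => by simpa using hδne φ
    have h : HasFixedRadiusDegree (fun φ ρ => displacement P T φ ρ + !₂[2 * (M : ℝ) * π, 0]) r
        (-0) := hasFixedRadiusDegree_of_hasWinding hcont hr hw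
    rwa [neg_zero] at h

end IsPolarLift

theorem lemma2p4 (T : ℝ) (hT : 0 < T)
    (L : ℝ → Mat2) (hLcont : ContinuousOn L (Icc 0 T)) (hLsymm : ∀ t ∈ Icc 0 T, (L t).IsSymm)
    (Ψ : ℝ → Mat2) (hΨ : IsFundamentalMatrix L T Ψ)
    (hnonres : (1 - Ψ T).det ≠ 0)
    (P : ℝ → ℝ → ℝ → ℝ × ℝ) (hP : IsPolarLift Ψ T P) :
    ((maslovIndex Ψ T = 0 → ∀ r > 0, HasFixedRadiusDegree (displacement P T) r (-2)) ∧
      (maslovIndex Ψ T ≠ 0 → ∀ r > 0, HasFixedRadiusDegree (displacement P T) r 0)) ∧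
    ∀ M : ℤ,
      (maslovIndex Ψ T = 2 * M → ∀ r > 0,
        HasFixedRadiusDegree
          (fun φ ρ => displacement P T φ ρ + !₂[2 * (M : ℝ) * Real.pi, 0]) r (-2)) ∧
      (maslovIndex Ψ T ≠ 2 * M → ∀ r > 0,
        HasFixedRadiusDegree
          (fun φ ρ => displacement P T φ ρ + !₂[2 * (M : ℝ) * Real.pi, 0]) r 0) := by
  have hdet := hΨ.det_eq_one hLsymm
  have hi : IsMaslovIndex Ψ T (maslovIndex Ψ T) := Classical.epsilon_spec
    (hP.exists_isMaslovIndex hT hΨ.continuousOn hdet hΨ.1 hnonres)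
  have key := fun (M : ℤ) (r : ℝ) (hr : 0 < r) =>
    hP.hasFixedRadiusDegree_displacement hT (hdet T ⟨hT.le, le_rfl⟩) hnonres hi M hr
  have hzero : (fun φ ρ => displacement P T φ ρ + !₂[2 * ((0 : ℤ) : ℝ) * π, 0]) =
      displacement P T := by
    ext φ ρ j
    fin_cases j <;> simp
  refine ⟨⟨fun h r hr => ?_, fun h r hr => ?_⟩, fun M => ⟨fun h r hr => ?_, fun h r hr => ?_⟩⟩
  · have := key 0 r hr
    rwa [hzero, if_pos (by rw [h, mul_zero])] at this
  · have := key 0 r hr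
    rwa [hzero, if_neg (by rwa [mul_zero])] at this
  · simpa only [if_pos h] using key M r hr
  · simpa only [if_neg h] using key M r hr
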